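/- Let $n\ge 1$ and let $Mb_n$ be the set of crossingless connections of the M\"obius band: systems of $n$ pairwise disjoint arcs joining $2n$ marked points on the boundary in pairs, without closed components, up to isotopy fixing the boundary. For $m_i,m_j\in Mb_n$, glue an inner M\"obius band containing $m_i$ to an outer one containing $m_j$ along their boundary circles, matching the labels of the marked points. The result is a collection of disjoint simple closed curves on a Klein bottle, and $\langle m_i,m_j\rangle\in\mathbb Z[d,w,x,y,z]$ is the product over these curves of the variable given by the type of the curve: $d$ for a homotopically trivial curve, $x$ for one that intersects (essentially) the inner crosscap only, $y$ for one that intersects the outer crosscap only, $w$ for one that intersects both crosscaps, and $z$ for one that separates the two crosscaps. Let $G_n=(\langle m_i,m_j\rangle)_{m_i,m_j\in Mb_n}$ be the Gram matrix of type $Mb$. Then, in $\mathbb Z[d,w,x,y,z]$, the determinant $\det G_n$ is divisible by $$\bigl(w(d+z)-2xy\bigr)^{\binom{2n}{n-1}} .$$ -/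

import Mathlib

namespace KleinGram

/-!
Model. The universal cover of the Moebius band is the strip `ℝ × [0,1]`; with `2 * n` marked points
on the boundary circle, the coordinate of `ℝ` is scaled so that the boundary has length `2 * n` and
the marked points lift to the integer points of the two boundary lines. The group of deck
transformations is infinite cyclic, generated by the glide reflection `(s, t) ↦ (s + n, 1 - t)`,
and a properly embedded arc of the band can be isotoped off the crosscap iff its lifts join points
of the same boundary line of the strip; otherwise it passes through the crosscap once.
-/

/-- Lifts of the marked points to the boundary of the strip: `(s, false)` is the point `s` of the
line `t = 0`, and `(s, true)` is the point `s` of the line `t = 1`. -/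
abbrev StripPt : Type := ℤ × Bool

/-- The generator `(s, t) ↦ (s + n, 1 - t)` of the group of deck transformations, on lifts of
marked points. -/
def deck (n : ℕ) (p : StripPt) : StripPt := (p.1 + n, !p.2)

/-- The label of the marked point below a lift. Two lifts have the same label iff they differ by
a deck transformation; the point `(s, false)` has label `s`. -/
def label (n : ℕ) (p : StripPt) : ZMod (2 * n) :=
  (((if p.2 then p.1 + n else p.1 : ℤ)) : ZMod (2 * n))

/-- The order in which the boundary of the strip is traversed: the line `t = 0` from left to right,
then the line `t = 1` from right to left. -/
def Before : StripPt → StripPt → Prop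
  | (s, false), (t, false) => s < t
  | (_, false), (_, true) => True
  | (_, true), (_, false) => False
  | (s, true), (t, true) => t < s

/-- Crossingless connections of `2 * n` marked points on the boundary of the Moebius band, up to
isotopy fixing the boundary. A system of `n` pairwise disjoint arcs joining the marked points is
determined up to isotopy by its preimage in the strip, and that preimage, the strip being a disc
without two boundary points, by the pairs of lifts that its arcs join. Such a pairing comes from
a system of arcs iff it is invariant under deck transformations and no two of its pairs separate
each other on the boundary of the strip. -/
@[ext]
structure Connection (n : ℕ) where
  /-- the other end of the lifted arc that ends at a given point -/
  mate : StripPt → StripPt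
  mate_mate : ∀ p, mate (mate p) = p
  mate_ne : ∀ p, mate p ≠ p
  mate_deck : ∀ p, mate (deck n p) = deck n (mate p)
  noncrossing : ∀ p q, ¬ (Before p q ∧ Before q (mate p) ∧ Before (mate p) (mate q))

namespace Connection

variable {n : ℕ}

theorem mate_deck_deck (m : Connection n) (a : ℤ) (s : Bool) :
    m.mate (a + 2 * n, s) = ((m.mate (a, s)).1 + 2 * n, (m.mate (a, s)).2) := by
  have h := m.mate_deck (deck n (a, s))
  rw [m.mate_deck (a, s)] at h
  simp only [deck, Bool.not_not] at h
  rw [show a + 2 * (n : ℤ) = a + n + n by ring, h]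
  exact Prod.ext (by simp only; ring) rfl

theorem mate_shift (m : Connection n) (k a : ℤ) (s : Bool) :
    m.mate (a + k * (2 * n), s) = ((m.mate (a, s)).1 + k * (2 * n), (m.mate (a, s)).2) := by
  induction k with
  | zero => simp
  | succ k ih =>
    have h := m.mate_deck_deck (a + k * (2 * n)) s
    rw [ih] at h
    rw [show a + ((k : ℤ) + 1) * (2 * n) = a + k * (2 * n) + 2 * n by ring, h]
    exact Prod.ext (by simp only; ring) rfl
  | pred k ih =>
    have h := m.mate_deck_deck (a + (-(k : ℤ) - 1) * (2 * n)) s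
    rw [show a + (-(k : ℤ) - 1) * (2 * n) + 2 * n = a + -(k : ℤ) * (2 * n) by ring, ih] at h
    have h1 := congrArg Prod.fst h
    have h2 := congrArg Prod.snd h
    simp only at h1 h2
    exact Prod.ext (by simp only; linarith) h2.symm

theorem mate_bound [NeZero n] (m : Connection n) (a : ℤ) :
    a - 2 * n ≤ (m.mate (a, false)).1 ∧ (m.mate (a, false)).1 ≤ a + 2 * n := by
  have hn : 0 < n := Nat.pos_of_ne_zero (NeZero.ne n)
  have hm := m.mate_mate (a, false)
  have h2 := m.mate_deck_deck a false
  have hd := m.mate_deck (a, false)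
  obtain ⟨⟨b, t⟩, hb⟩ : ∃ q, m.mate (a, false) = q := ⟨_, rfl⟩
  rw [hb] at hm h2 hd ⊢
  cases t
  · have h3 := m.mate_deck_deck b false
    rw [hm] at h3
    simp only at h2 h3
    have c1 := m.noncrossing (a, false) (a + 2 * n, false)
    have c2 := m.noncrossing (b, false) (b + 2 * n, false)
    rw [hb, h2] at c1
    rw [hm, h3] at c2
    simp only [Before] at c1 c2 ⊢
    omega
  · have he := m.mate_deck (b, true)
    rw [hm] at he
    simp only [deck, Bool.not_false, Bool.not_true] at hd he
    have c1 := m.noncrossing (a, false) (b + n, false)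
    have c2 := m.noncrossing (b + n, false) (a, false)
    rw [hb, he] at c1
    rw [hb, he] at c2
    simp only [Before, true_and] at c1 c2 ⊢
    omega

/-- There are finitely many crossingless connections. -/
instance [NeZero n] : Finite (Connection n) := by
  have hn : 0 < n := Nat.pos_of_ne_zero (NeZero.ne n)
  let f : Connection n → Fin (2 * n) → Set.Icc (-(2 * n : ℤ)) (4 * n) × Bool := fun m i =>
    (⟨(m.mate ((i : ℤ), false)).1, by
      have h := m.mate_bound (i : ℤ)
      have hi := i.2
      constructor <;> omega⟩, (m.mate ((i : ℤ), false)).2)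
  refine Finite.of_injective f fun m m' h => ?_
  have key : ∀ a : ℤ, m.mate (a, false) = m'.mate (a, false) := by
    intro a
    have hpos : (0 : ℤ) < 2 * n := by omega
    have h0 := Int.emod_nonneg a hpos.ne'
    have h1 := Int.emod_lt_of_pos a hpos
    have hi := congrFun h ⟨(a % (2 * n)).toNat, by omega⟩
    simp only [f, Prod.mk.injEq, Subtype.mk.injEq, Int.toNat_of_nonneg h0] at hi
    have ha : a = a % (2 * n) + a / (2 * n) * (2 * n) := by
      rw [mul_comm (a / _)]; exact (Int.emod_add_mul_ediv a (2 * n)).symm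
    rw [ha, m.mate_shift, m'.mate_shift, hi.1, hi.2]
  ext1
  funext p
  obtain ⟨a, s⟩ := p
  cases s
  · exact key a
  · have e : ((a, true) : StripPt) = deck n (a - n, false) := by simp [deck]
    rw [e, m.mate_deck, m'.mate_deck, key]

noncomputable instance [NeZero n] : Fintype (Connection n) := Fintype.ofFinite _

/-- The arc of `m` that ends at the marked point `i` passes through the crosscap: its lifts join
the two boundary lines of the strip. -/
def Crosses (m : Connection n) (i : ZMod (2 * n)) : Prop :=
  ∃ p : StripPt, label n p = i ∧ (m.mate p).2 ≠ p.2

/-- The marked points `i` and `j` are the ends of an arc of `m`. -/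
def Joins (m : Connection n) (i j : ZMod (2 * n)) : Prop :=
  ∃ p : StripPt, label n p = i ∧ label n (m.mate p) = j

end Connection

/-- The five types of simple closed curves on the Klein bottle obtained by gluing an inner and an
outer Moebius band along their boundaries: `d` is homotopically trivial, `w` intersects both
crosscaps, `x` intersects the inner one only, `y` intersects the outer one only, and `z` separates
the two crosscaps. -/
inductive CurveType : Type
  | d | w | x | y | z

variable {n : ℕ}

/-- The graph on the marked points whose edges are the arcs of `m₁` and of `m₂`. -/
def glueGraph (m₁ m₂ : Connection n) : SimpleGraph (ZMod (2 * n)) :=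
  SimpleGraph.fromRel fun i j => m₁.Joins i j ∨ m₂.Joins i j

/-- The closed curves on the Klein bottle formed by `m₁` in the inner and `m₂` in the outer Moebius
band, glued along the boundary with the labels of the marked points matching: each consists of the
arcs in one connected component of the graph of all arcs. -/
abbrev ClosedCurve (m₁ m₂ : Connection n) : Type := (glueGraph m₁ m₂).ConnectedComponent

namespace ClosedCurve

variable {m₁ m₂ : Connection n}

/-- The number of arcs of the curve that pass through the inner crosscap (each such arc is counted
at both of its ends). -/
noncomputable def innerCrossings (c : ClosedCurve m₁ m₂) : ℕ :=
  {i ∈ c.supp | m₁.Crosses i}.ncard / 2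

/-- The number of arcs of the curve that pass through the outer crosscap. -/
noncomputable def outerCrossings (c : ClosedCurve m₁ m₂) : ℕ :=
  {i ∈ c.supp | m₂.Crosses i}.ncard / 2

/-- The curve lifts to a closed curve in the infinite cyclic cover of the Klein bottle that consists
of two strips glued along both boundary lines: following the lifted arcs of `m₁` and `m₂`
alternately, one returns to the starting point. -/
def LiftsClosed (c : ClosedCurve m₁ m₂) : Prop :=
  ∀ p : StripPt, label n p ∈ c.supp → p ∈ Function.periodicPts (m₂.mate ∘ m₁.mate)

open Classical in
/-- The type of a curve. A simple closed curve on the Klein bottle that passes through both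
crosscaps an even number of times is trivial or separates the crosscaps; the infinite cyclic
cover is an open annulus, in which the trivial curve lifts to closed curves and the separating one,
which represents the square of a generator of the deck group, does not. -/
noncomputable def type (c : ClosedCurve m₁ m₂) : CurveType :=
  if Odd c.innerCrossings then
    if Odd c.outerCrossings then .w else .x
  else
    if Odd c.outerCrossings then .y else if c.LiftsClosed then .d else .z

end ClosedCurve

noncomputable instance [NeZero n] (m₁ m₂ : Connection n) : Fintype (ClosedCurve m₁ m₂) :=
  haveI : NeZero (2 * n) := ⟨mul_ne_zero two_ne_zero (NeZero.ne n)⟩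
  Fintype.ofFinite _

/-- The value of the bilinear form on two crossingless connections: the monomial in
`ℤ[d, w, x, y, z]` recording the closed curves that they form on the Klein bottle. -/
noncomputable def form [NeZero n] (m₁ m₂ : Connection n) : MvPolynomial CurveType ℤ :=
  ∏ c : ClosedCurve m₁ m₂, MvPolynomial.X c.type

/-- The Gram matrix of type `Mb`. -/
noncomputable def gramMatrix (n : ℕ) [NeZero n] :
    Matrix (Connection n) (Connection n) (MvPolynomial CurveType ℤ) :=
  Matrix.of fun m₁ m₂ => form m₁ m₂

open Classical in
/-- The Gram determinant of type `Mb`. -/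
noncomputable def gramDet (n : ℕ) [NeZero n] : MvPolynomial CurveType ℤ :=
  (gramMatrix n).det

end KleinGram

/-! Fix n - 1 disjoint arcs that avoid the crosscap and leave two marked points free. The free
points can be joined by an arc through the crosscap or by one of two arcs off it (`crossArc`,
`sideArc`), which gives three rows of the Gram matrix. Against any column `m` the three glued
pictures differ only in the curve through the new arc: the old arcs and those of `m` form one strand
between the free points, and all other curves contribute a common factor R (`exists_form_insert`).

Lift the strand to the strip. If its ends lie on different boundary lines, it crosses the outer
crosscap an odd number of times (`odd_card_crossing_iff`), so the three arcs close it to types w, y,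
y. If they lie on the same line, they are neighbouring free points (`strand_ends_le`), so one side
arc closes the lift (type d), the other joins it to a different translate (type z), and the crossing
arc gives x. Hence (d + z)·(crossing row) - x·(sum of the side rows) is (w(d + z) - 2xy)·R in the
first case and 0 in the second (`typeOn_strand`, `dvd_form_combination`).

There are binom(2n, n - 1) such arc systems, one for each choice of n - 1 ascending steps of a
periodic lattice path (`exists_cupSystem_family`), and their crossing rows are distinct. Performing
all the row operations at once (`Matrix.pow_card_dvd_mul_det`) shows that the required power divides
a power of d + z times the determinant. The factor d + z can be cancelled because it is coprime to
w(d + z) - 2xy (`isRelPrime_d_add_z`). -/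

namespace KleinGram

/-! ### Arc systems with two free points from periodic lattice paths -/

/-- The lifts, to one boundary line of the strip, of the ends of pairwise disjoint arcs that avoid
the crosscap (`cup`), where two further marked points (with lifts `free i`) are not yet joined. -/
structure CupSystem (n : ℕ) where
  cup : ℤ → ℤ
  free : ℤ → ℤ
  cup_cup : ∀ i, cup (cup i) = i
  cup_add : ∀ i, cup (i + 2 * n) = cup i + 2 * n
  free_strictMono : StrictMono free
  free_add_two : ∀ i, free (i + 2) = free i + 2 * n
  cup_eq_self : ∀ i, cup i = i ↔ ∃ k, free k = i
  noncrossing : ∀ i j, ¬ (i < j ∧ j < cup i ∧ cup i < cup j)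
  uncovered : ∀ i k, ¬ (i < free k ∧ free k < cup i)

/-- A lattice path `height` with steps `±1` that loses two units in each period `2 * n`. -/
structure HeightFunction (n : ℕ) where
  height : ℤ → ℤ
  step : ∀ i, height (i + 1) = height i + 1 ∨ height (i + 1) = height i - 1
  drift : ∀ i, height (i + 2 * n) = height i - 2

namespace HeightFunction

variable {n : ℕ} (h : HeightFunction n)

theorem height_shift (k i : ℤ) : h.height (i + k * (2 * n)) = h.height i - 2 * k := by
  induction k with
  | zero => simp
  | succ k ih =>
    rw [show i + ((k : ℤ) + 1) * (2 * n) = i + k * (2 * n) + 2 * n by ring, h.drift, ih]; ring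
  | pred k ih =>
    have := h.drift (i + (-(k : ℤ) - 1) * (2 * n))
    rw [show i + (-(k : ℤ) - 1) * (2 * n) + 2 * n = i + -(k : ℤ) * (2 * n) by ring, ih] at this
    linarith

theorem abs_height_sub_le (i : ℤ) (k : ℕ) : |h.height (i + k) - h.height i| ≤ k := by
  induction k with
  | zero => simp
  | succ k ih =>
    have := h.step (i + k)
    rw [abs_le] at ih ⊢
    push_cast
    rw [← add_assoc]
    omega

theorem exists_forall_lt_height [NeZero n] (v : ℤ) : ∃ N, ∀ t ≤ N, v < h.height t := by
  have hn : 0 < n := Nat.pos_of_ne_zero (NeZero.ne n)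
  -- Each period to the left gains two units, while within a period the height stays within `2 * n`
  -- of its value at 0; this many periods make up for both.
  refine ⟨-(2 * n * (|v| + |h.height 0| + 2 * n + 1)), fun t ht => ?_⟩
  have hpos : (0 : ℤ) < 2 * n := by omega
  have h0 := Int.emod_nonneg t hpos.ne'
  have h1 := Int.emod_lt_of_pos t hpos
  have e : t = t % (2 * n) + t / (2 * n) * (2 * n) := by
    rw [mul_comm (t / _)]; exact (Int.emod_add_mul_ediv t (2 * n)).symm
  have hq : t / (2 * n) ≤ -(|v| + |h.height 0| + 2 * n + 1) := by
    have : t / (2 * n) * (2 * n) ≤ -(|v| + |h.height 0| + 2 * n + 1) * (2 * n) := by linarith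
    exact le_of_mul_le_mul_right this hpos
  have h2 := h.abs_height_sub_le 0 (t % (2 * n)).toNat
  rw [Int.toNat_of_nonneg h0, zero_add, abs_le] at h2
  rw [e, h.height_shift]
  have h3 := le_abs_self v
  have h4 := neg_abs_le (h.height 0)
  have h5 := abs_nonneg v
  linarith [abs_nonneg (h.height 0)]

theorem exists_height_le [NeZero n] (v : ℤ) (s : ℤ) : ∃ t, s ≤ t ∧ h.height t ≤ v := by
  refine ⟨s + |h.height s - v| * (2 * n), ?_, ?_⟩
  · have := abs_nonneg (h.height s - v)
    nlinarith [Int.natCast_nonneg n]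
  · rw [h.height_shift]
    have := le_abs_self (h.height s - v)
    have := abs_nonneg (h.height s - v)
    linarith

/-- The path descends from arbitrarily large heights on the left by unit steps, so the first time it
is at most `v` it equals `v`. -/
theorem exists_first [NeZero n] (v : ℤ) :
    ∃ t, h.height (t + 1) = v ∧ ∀ s ≤ t, v < h.height s := by
  obtain ⟨N, hN⟩ := h.exists_forall_lt_height v
  obtain ⟨t, _, ht⟩ := h.exists_height_le v 0
  obtain ⟨m, hm, hmin⟩ := Int.exists_least_of_bdd (P := fun t => h.height t ≤ v)
    ⟨N, fun z hz => by by_contra hlt; exact absurd (hN z (by omega)) (not_lt.2 hz)⟩ ⟨t, ht⟩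
  have hlt : ∀ s ≤ m - 1, v < h.height s := by
    intro s hs; by_contra hc; have := hmin s (by omega); omega
  refine ⟨m - 1, ?_, hlt⟩
  have h1 := hlt (m - 1) le_rfl
  have h2 := h.step (m - 1)
  rw [sub_add_cancel] at *
  omega

/-- The two ends of an arc that runs below the graph of the height function. -/
def Below (i j : ℤ) : Prop :=
  i < j ∧ h.height i = h.height (j + 1) ∧ ∀ t, i < t → t ≤ j → h.height i < h.height t

def Arc (i j : ℤ) : Prop := h.Below i j ∨ h.Below j i

variable {h}

theorem Below.up {i j : ℤ} (b : h.Below i j) : h.height (i + 1) = h.height i + 1 := by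
  have := h.step i
  have := b.2.2 (i + 1) (by omega) b.1
  omega

theorem Below.down {i j : ℤ} (b : h.Below i j) : h.height (j + 1) = h.height j - 1 := by
  have := h.step j
  have := b.2.2 j b.1 le_rfl
  have := b.2.1
  omega

theorem Arc.symm {i j : ℤ} (b : h.Arc i j) : h.Arc j i := Or.symm b

theorem Arc.unique {i j k : ℤ} (b : h.Arc i j) (c : h.Arc i k) : j = k := by
  rcases b with b | b <;> rcases c with c | c
  · by_contra hne
    rcases lt_or_gt_of_ne hne with hlt | hlt
    · have := c.2.2 (j + 1) (by have := b.1; omega) (by omega)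
      have := b.2.1
      omega
    · have := b.2.2 (k + 1) (by have := c.1; omega) (by omega)
      have := c.2.1
      omega
  · have := b.up; have := c.down; omega
  · have := c.up; have := b.down; omega
  · by_contra hne
    have := b.2.1
    have := c.2.1
    rcases lt_or_gt_of_ne hne with hlt | hlt
    · have := b.2.2 k hlt c.1.le
      omega
    · have := c.2.2 j hlt b.1.le
      omega

/-- A crossing would force the heights at `i`, `k`, `j + 1` to increase strictly, although those at
`i` and `j + 1` agree. -/
theorem Below.noncrossing {i j k l : ℤ} (b : h.Below i j) (c : h.Below k l) :
    ¬ (i < k ∧ k < j ∧ j < l) := by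
  rintro ⟨h1, h2, h3⟩
  have := b.2.2 k h1 h2.le
  have := c.2.2 (j + 1) (by omega) (by omega)
  have := b.2.1
  omega

theorem Below.shift {i j : ℤ} (b : h.Below i j) : h.Below (i + 2 * n) (j + 2 * n) := by
  obtain ⟨h1, h2, h3⟩ := b
  refine ⟨by omega, ?_, fun t ht ht' => ?_⟩
  · rw [show j + 2 * (n : ℤ) + 1 = j + 1 + 2 * n by ring, h.drift, h.drift, h2]
  · have h4 := h3 (t - 2 * n) (by omega) (by omega)
    have h5 := h.drift (t - 2 * n)
    rw [sub_add_cancel] at h5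
    rw [h.drift, h5]
    omega

theorem Arc.shift {i j : ℤ} (b : h.Arc i j) : h.Arc (i + 2 * n) (j + 2 * n) :=
  Or.imp Below.shift Below.shift b

variable (h)

/-- The step at `i` reaches a new minimum. -/
def Record (i : ℤ) : Prop := ∀ t ≤ i, h.height (i + 1) < h.height t

/-- Parenthesis matching: an ascending step is closed by the first return to its starting height,
which exists because the path drifts down. A descending step is opened at the last earlier time the
path was no higher than its endpoint; if there is no such time, it is a record. -/
theorem exists_arc_or_record [NeZero n] (i : ℤ) : (∃ j, h.Arc i j) ∨ h.Record i := by
  rcases h.step i with hi | hi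
  · left
    obtain ⟨t, ht, ht'⟩ := h.exists_height_le (h.height i) (i + 1)
    obtain ⟨m, ⟨hm, hm'⟩, hmin⟩ := Int.exists_least_of_bdd
      (P := fun t => i + 1 ≤ t ∧ h.height t ≤ h.height i) ⟨i + 1, fun z hz => hz.1⟩ ⟨t, ht, ht'⟩
    have hlt : ∀ s, i < s → s ≤ m - 1 → h.height i < h.height s := by
      intro s hs hs'; by_contra hc; have := hmin s ⟨by omega, by omega⟩; omega
    have hne : i + 1 ≠ m := by rintro rfl; omega
    have h1 := hlt (m - 1) (by omega) le_rfl
    have h2 := h.step (m - 1)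
    refine ⟨m - 1, Or.inl ⟨by omega, ?_, hlt⟩⟩
    rw [sub_add_cancel] at *
    omega
  · by_cases hr : h.Record i
    · exact Or.inr hr
    · left
      simp only [Record, not_forall, not_lt] at hr
      obtain ⟨t, ht, ht'⟩ := hr
      obtain ⟨m, ⟨hm, hm'⟩, hmax⟩ := Int.exists_greatest_of_bdd
        (P := fun t => t ≤ i ∧ h.height t ≤ h.height (i + 1)) ⟨i, fun z hz => hz.1⟩ ⟨t, ht, ht'⟩
      have hlt : ∀ s, m < s → s ≤ i → h.height (i + 1) < h.height s := by
        intro s hs hs'; by_contra hc; have := hmax s ⟨by omega, by omega⟩; omega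
      have hne : m ≠ i := by rintro rfl; omega
      have h1 := hlt (m + 1) (by omega) (by omega)
      have h2 := h.step m
      have h3 : h.height m = h.height (i + 1) := by omega
      exact ⟨m, Or.inr ⟨by omega, h3, fun s hs hs' => h3 ▸ hlt s hs hs'⟩⟩

variable {h}

theorem Record.not_arc {i j : ℤ} (hr : h.Record i) : ¬ h.Arc i j := by
  rintro (b | b)
  · have := b.up; have := hr i le_rfl; omega
  · have := b.2.1; have := hr j b.1.le; omega

theorem Record.not_below {i j k : ℤ} (hr : h.Record k) (b : h.Below i j) : ¬ (i < k ∧ k < j) := by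
  rintro ⟨h1, h2⟩
  have := hr i h1.le
  have := b.2.2 (k + 1) (by omega) h2
  omega

variable (h) [NeZero n]

-- The default value turns the unmatched steps, that is the records, into the fixed points required
-- by `CupSystem.cup_eq_self`.
open Classical in
noncomputable def partner (i : ℤ) : ℤ := if hi : ∃ j, h.Arc i j then hi.choose else i

theorem arc_partner_or (i : ℤ) : h.Arc i (h.partner i) ∨ h.partner i = i ∧ h.Record i := by
  by_cases hi : ∃ j, h.Arc i j
  · left; rw [partner, dif_pos hi]; exact hi.choose_spec
  · right; exact ⟨by rw [partner, dif_neg hi], (h.exists_arc_or_record i).resolve_left hi⟩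

variable {h}

theorem Arc.partner_eq {i j : ℤ} (b : h.Arc i j) : h.partner i = j := by
  rcases h.arc_partner_or i with c | ⟨_, hr⟩
  · exact c.unique b
  · exact absurd b hr.not_arc

theorem Record.partner_eq {i : ℤ} (hr : h.Record i) : h.partner i = i := by
  rcases h.arc_partner_or i with c | ⟨e, _⟩
  · exact absurd c hr.not_arc
  · exact e

theorem below_of_lt_partner {i : ℤ} (hi : i < h.partner i) : h.Below i (h.partner i) := by
  rcases h.arc_partner_or i with (c | c) | ⟨e, _⟩
  · exact c
  · have := c.1; omega
  · omega

theorem lt_partner_iff (i : ℤ) : i < h.partner i ↔ h.height (i + 1) = h.height i + 1 := by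
  constructor
  · exact fun hi => (below_of_lt_partner hi).up
  · intro hi
    rcases h.arc_partner_or i with (c | c) | ⟨_, hr⟩
    · exact c.1
    · have := c.down; omega
    · have := hr i le_rfl; omega

variable (h)

noncomputable def firstAt (v : ℤ) : ℤ := (h.exists_first v).choose

theorem height_firstAt (v : ℤ) : h.height (h.firstAt v + 1) = v := (h.exists_first v).choose_spec.1

theorem lt_height_of_le_firstAt (v : ℤ) : ∀ s ≤ h.firstAt v, v < h.height s :=
  (h.exists_first v).choose_spec.2

theorem firstAt_unique {v t : ℤ} (h1 : h.height (t + 1) = v) (h2 : ∀ s ≤ t, v < h.height s) :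
    h.firstAt v = t := by
  have h3 := h.height_firstAt v
  have h4 := h.lt_height_of_le_firstAt v
  rcases lt_trichotomy (h.firstAt v) t with hlt | he | hlt
  · have := h2 (h.firstAt v + 1) hlt; omega
  · exact he
  · have := h4 (t + 1) hlt; omega

theorem record_firstAt (v : ℤ) : h.Record (h.firstAt v) := fun t ht => by
  rw [h.height_firstAt]; exact h.lt_height_of_le_firstAt v t ht

/-- The arcs below a height function, the free points being its records. -/
noncomputable def toCupSystem : CupSystem n where
  cup := h.partner
  -- The sign makes the free points increase with their index, since lower levels are reached later;
  -- the loss of two units per period then becomes `free_add_two`.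
  free i := h.firstAt (-i)
  cup_cup i := by
    rcases h.arc_partner_or i with c | ⟨e, _⟩
    · exact c.symm.partner_eq
    · rw [e, e]
  cup_add i := by
    rcases h.arc_partner_or i with c | ⟨e, hr⟩
    · exact c.shift.partner_eq
    · rw [e]
      refine Record.partner_eq fun t ht => ?_
      have h1 := hr (t - 2 * n) (by omega)
      have h2 := h.drift (t - 2 * n)
      rw [sub_add_cancel] at h2
      rw [show i + 2 * (n : ℤ) + 1 = i + 1 + 2 * n by ring, h.drift, h2]
      omega
  free_strictMono := strictMono_int_of_lt_succ fun i => by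
    by_contra hc
    have h1 := h.lt_height_of_le_firstAt (-i) (h.firstAt (-(i + 1)) + 1)
    rw [h.height_firstAt] at h1
    rcases lt_or_eq_of_le (not_lt.1 hc) with hlt | he
    · have := h1 hlt; omega
    · have h2 := h.height_firstAt (-i)
      rw [← he, h.height_firstAt] at h2
      omega
  free_add_two i := by
    refine h.firstAt_unique ?_ fun s hs => ?_
    · rw [show h.firstAt (-i) + 2 * (n : ℤ) + 1 = h.firstAt (-i) + 1 + 2 * n by ring, h.drift,
        h.height_firstAt]
      ring
    · have h1 := h.lt_height_of_le_firstAt (-i) (s - 2 * n) (by omega)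
      have h2 := h.drift (s - 2 * n)
      rw [sub_add_cancel] at h2
      rw [h2]
      omega
  cup_eq_self i := by
    constructor
    · intro hi
      rcases h.arc_partner_or i with (c | c) | ⟨_, hr⟩
      · have := c.1; omega
      · have := c.1; omega
      · exact ⟨-h.height (i + 1), by rw [neg_neg]; exact h.firstAt_unique rfl hr⟩
    · rintro ⟨k, rfl⟩
      exact (h.record_firstAt _).partner_eq
  noncrossing i j := by
    rintro ⟨h1, h2, h3⟩
    exact (below_of_lt_partner (h1.trans h2)).noncrossing (below_of_lt_partner (h2.trans h3))
      ⟨h1, h2, h3⟩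
  uncovered i k hk :=
    (h.record_firstAt _).not_below (below_of_lt_partner (hk.1.trans hk.2)) hk

theorem lt_cup_iff (i : ℤ) :
    i < h.toCupSystem.cup i ↔ h.height (i + 1) = h.height i + 1 := lt_partner_iff i

end HeightFunction

/-- Twice the number of lifts of elements of `S` in `[0, i)`, minus `i`. -/
def heightFun {n : ℕ} (S : Finset (Fin (2 * n))) (i : ℤ) : ℤ :=
  2 * ∑ s ∈ S, -(((s : ℕ) - i : ℤ) / (2 * n : ℤ)) - i

theorem heightFun_succ {n : ℕ} [NeZero n] (S : Finset (Fin (2 * n))) (i : ℤ) :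
    heightFun S (i + 1) = heightFun S i - 1 +
      2 * ({s ∈ S | (2 * n : ℤ) ∣ (s : ℕ) - i} : Finset (Fin (2 * n))).card := by
  have hn : 0 < n := Nat.pos_of_ne_zero (NeZero.ne n)
  have hpos : (0 : ℤ) < 2 * n := by omega
  -- The floor drops exactly when `a` is a multiple of the period, so a summand of `heightFun` jumps
  -- at the lifts of its residue.
  have key : ∀ a : ℤ, -((a - 1) / (2 * n : ℤ)) =
      -(a / (2 * n : ℤ)) + if (2 * n : ℤ) ∣ a then 1 else 0 := by
    intro a
    split_ifs with ha
    · obtain ⟨k, rfl⟩ := ha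
      rw [Int.mul_ediv_cancel_left _ hpos.ne',
        show (2 * n : ℤ) * k - 1 = (2 * n - 1) + (2 * n) * (k - 1) by ring,
        Int.add_mul_ediv_left _ _ hpos.ne', Int.ediv_eq_zero_of_lt (by omega) (by omega)]
      ring
    · have h0 := Int.emod_nonneg a hpos.ne'
      have h1 := Int.emod_lt_of_pos a hpos
      have h2 : a % (2 * n) ≠ 0 := fun h => ha (Int.dvd_of_emod_eq_zero h)
      have e := Int.emod_add_mul_ediv a (2 * n)
      rw [show a - 1 = (a % (2 * n) - 1) + (2 * n) * (a / (2 * n)) by linarith,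
        Int.add_mul_ediv_left _ _ hpos.ne', Int.ediv_eq_zero_of_lt (by omega) (by omega)]
      ring
  have e : ∀ s : Fin (2 * n), -(((s : ℕ) - (i + 1) : ℤ) / (2 * n : ℤ)) =
      -(((s : ℕ) - i : ℤ) / (2 * n : ℤ)) + if (2 * n : ℤ) ∣ (s : ℕ) - i then 1 else 0 := by
    intro s
    rw [← key, sub_sub]
  simp only [heightFun, e, Finset.sum_add_distrib, Finset.sum_boole]
  ring

theorem heightFun_step {n : ℕ} [NeZero n] (S : Finset (Fin (2 * n))) (i : ℤ) :
    heightFun S (i + 1) = heightFun S i + 1 ∨ heightFun S (i + 1) = heightFun S i - 1 := by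
  have : ({s ∈ S | (2 * n : ℤ) ∣ (s : ℕ) - i} : Finset (Fin (2 * n))).card ≤ 1 := by
    refine Finset.card_le_one.2 fun s hs t ht => Fin.ext ?_
    obtain ⟨k, hk⟩ := dvd_sub (Finset.mem_filter.1 hs).2 (Finset.mem_filter.1 ht).2
    have h1 := s.2
    have h2 := t.2
    have h3 : k < 1 := by by_contra hc; nlinarith
    have h4 : -1 < k := by by_contra hc; nlinarith
    have h5 : k = 0 := by omega
    subst h5
    omega
  rw [heightFun_succ]
  omega

/-- The height function whose ascending steps are those at the residues in `S`. -/
def heightOf {n : ℕ} [NeZero n] (S : Finset (Fin (2 * n))) (hS : S.card = n - 1) :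
    HeightFunction n where
  height := heightFun S
  step := heightFun_step S
  -- Each of the n - 1 summands grows by one in a period, and 2(n - 1) - 2n = -2.
  drift i := by
    have hn : 0 < n := Nat.pos_of_ne_zero (NeZero.ne n)
    have hpos : (2 * n : ℤ) ≠ 0 := by omega
    have e : ∀ s : Fin (2 * n), -(((s : ℕ) - (i + 2 * n) : ℤ) / (2 * n : ℤ)) =
        -(((s : ℕ) - i : ℤ) / (2 * n : ℤ)) + 1 := by
      intro s
      rw [show ((s : ℕ) - (i + 2 * n) : ℤ) = ((s : ℕ) - i) + (2 * n) * (-1) by ring,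
        Int.add_mul_ediv_left _ _ hpos]
      ring
    simp only [heightFun, e, Finset.sum_add_distrib, Finset.sum_const, hS, nsmul_eq_mul, mul_one]
    push_cast [Nat.cast_sub (show 1 ≤ n from hn)]
    ring

theorem heightOf_up_iff {n : ℕ} [NeZero n] (S : Finset (Fin (2 * n))) (hS : S.card = n - 1)
    (s : Fin (2 * n)) :
    (heightOf S hS).height ((s : ℕ) + 1) = (heightOf S hS).height (s : ℕ) + 1 ↔ s ∈ S := by
  have h1 := heightFun_succ S (s : ℕ)
  have h2 := heightFun_step S (s : ℕ)
  change heightFun S ((s : ℕ) + 1) = heightFun S (s : ℕ) + 1 ↔ _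
  constructor
  · intro h3
    obtain ⟨t, ht⟩ : ({t ∈ S | (2 * n : ℤ) ∣ (t : ℕ) - (s : ℕ)} : Finset (Fin (2 * n))).Nonempty := by
      rw [← Finset.card_pos]; omega
    obtain ⟨ht, k, hk⟩ := Finset.mem_filter.1 ht
    have h4 := s.2
    have h5 := t.2
    have h6 : k < 1 := by by_contra hc; nlinarith
    have h7 : -1 < k := by by_contra hc; nlinarith
    have h8 : k = 0 := by omega
    subst h8
    rwa [show s = t from Fin.ext (by omega)]
  · intro hs
    have : 0 < ({t ∈ S | (2 * n : ℤ) ∣ (t : ℕ) - (s : ℕ)} : Finset (Fin (2 * n))).card :=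
      Finset.card_pos.2 ⟨s, Finset.mem_filter.2 ⟨hs, by simp⟩⟩
    omega

/-- The ascending steps are the left ends of arcs, so the arc system determines `S`. -/
theorem exists_cupSystem_family (n : ℕ) [NeZero n] :
    ∃ C : {S : Finset (Fin (2 * n)) // S.card = n - 1} → CupSystem n,
      ∀ S S', (∀ i, i < (C S).cup i ↔ i < (C S').cup i) → S = S' := by
  refine ⟨fun S => (heightOf S.1 S.2).toCupSystem, fun S S' hs => ?_⟩
  ext s
  have := hs (s : ℕ)
  simpa only [HeightFunction.lt_cup_iff, heightOf_up_iff] using this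

end KleinGram

/-! ### Divisibility of a determinant by simultaneous row operations -/

theorem Matrix.pow_card_dvd_mul_det {ι κ R : Type*} [Fintype ι] [DecidableEq ι] [Fintype κ]
    [CommRing R] (G : Matrix ι ι R) (a b c : κ → ι) (hc : Function.Injective c)
    (ha : ∀ k l, a k ≠ c l) (hb : ∀ k l, b k ≠ c l) (p u v : R)
    (h : ∀ k j, p ∣ v * G (c k) j - u * (G (a k) j + G (b k) j)) :
    p ^ Fintype.card κ ∣ v ^ Fintype.card κ * G.det := by
  classical
  -- The matrix after the row operations for `k ∈ t`. Rows `a k` and `b k` are never modified, so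
  -- the order of the operations is irrelevant.
  let N : Finset κ → Matrix ι ι R := fun t => Matrix.of fun i j =>
    if h : ∃ k ∈ t, c k = i then v * G i j - u * (G (a h.choose) j + G (b h.choose) j) else G i j
  have hN : ∀ t k, k ∈ t → ∀ j, N t (c k) j = v * G (c k) j - u * (G (a k) j + G (b k) j) := by
    intro t k hk j
    have hx : ∃ k' ∈ t, c k' = c k := ⟨k, hk, rfl⟩
    have he : hx.choose = k := hc hx.choose_spec.2
    simp only [N, Matrix.of_apply, dif_pos hx, he]
  have hN' : ∀ t i, (∀ k ∈ t, c k ≠ i) → ∀ j, N t i j = G i j := by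
    intro t i hi j
    have hx : ¬ ∃ k' ∈ t, c k' = i := fun ⟨k, hk, e⟩ => hi k hk e
    simp only [N, Matrix.of_apply, dif_neg hx]
  have hdet : ∀ t : Finset κ, (N t).det = v ^ t.card * G.det := by
    intro t
    induction t using Finset.induction_on with
    | empty =>
      have : N ∅ = G := by ext i j; exact hN' _ _ (by simp) j
      simp [this]
    | insert k t hk ih =>
      -- By linearity in row `c k`, the summands from rows `a k` and `b k` give matrices with a
      -- repeated row, and only the factor `v` remains.
      have e : N (insert k t) = ((N t).updateRow (c k)
          (v • N t (c k) + (-u) • N t (a k) + (-u) • N t (b k))) := by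
        ext i j
        by_cases hi : i = c k
        · subst hi
          rw [Matrix.updateRow_self, hN _ k (Finset.mem_insert_self _ _)]
          simp only [Pi.add_apply, Pi.smul_apply, smul_eq_mul]
          rw [hN' t (c k) (fun l hl e => hk (hc e ▸ hl)), hN' t (a k) (fun l _ e => ha k l e.symm),
            hN' t (b k) (fun l _ e => hb k l e.symm)]
          ring
        · rw [Matrix.updateRow_ne hi]
          by_cases hx : ∃ l ∈ t, c l = i
          · obtain ⟨l, hl, rfl⟩ := hx
            rw [hN _ l (Finset.mem_insert_of_mem hl), hN _ l hl]
          · rw [hN' _ i, hN' _ i]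
            · exact fun l hl e => hx ⟨l, hl, e⟩
            · intro l hl e
              rcases Finset.mem_insert.1 hl with rfl | hl
              · exact hi e.symm
              · exact hx ⟨l, hl, e⟩
      rw [e, Matrix.det_updateRow_add, Matrix.det_updateRow_add, Matrix.det_updateRow_smul,
        Matrix.det_updateRow_smul, Matrix.det_updateRow_smul, Matrix.updateRow_eq_self,
        Matrix.det_updateRow_eq_zero (ha k k), Matrix.det_updateRow_eq_zero (hb k k), ih,
        Finset.card_insert_of_notMem hk]
      ring
  rw [← Finset.card_univ, ← hdet]
  choose q hq using h
  -- After all operations each row `c k` is a multiple of `p`; the factors are pulled out row by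
  -- row.
  let r : ι → R := fun i => if i ∈ Finset.univ.image c then p else 1
  let N' : Matrix ι ι R := Matrix.of fun i j => if h : ∃ k, c k = i then q h.choose j else G i j
  have e : N Finset.univ = Matrix.of fun i j => r i * N' i j := by
    ext i j
    by_cases hx : ∃ k, c k = i
    · obtain ⟨k, rfl⟩ := hx
      have hx : ∃ k', c k' = c k := ⟨k, rfl⟩
      have he : hx.choose = k := hc hx.choose_spec
      rw [hN _ k (Finset.mem_univ _), hq]
      simp only [r, N', Matrix.of_apply, dif_pos hx, he]
      simp
    · rw [hN' _ i (fun k _ e => hx ⟨k, e⟩)]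
      simp only [r, N', Matrix.of_apply, dif_neg hx]
      rw [if_neg (by simpa using hx), one_mul]
  rw [e, Matrix.det_mul_column]
  refine Dvd.dvd.mul_right ?_ _
  simp only [r]
  rw [Finset.prod_ite_mem, Finset.univ_inter, Finset.prod_const, Finset.card_image_of_injective _ hc]

/-! ### Coprimality of the two polynomial factors -/

namespace KleinGram

-- A common divisor divides 2xy. None of the primes 2, x, y divides d + z: at d = 1 with all other
-- variables 0, they take non-unit values while d + z becomes 1.
open MvPolynomial in
theorem isRelPrime_d_add_z : IsRelPrime
    (X CurveType.w * (X CurveType.d + X CurveType.z) - 2 * (X CurveType.x * X CurveType.y))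
    (X CurveType.d + X CurveType.z : MvPolynomial CurveType ℤ) := by
  have key : ∀ (q : MvPolynomial CurveType ℤ) (g : CurveType → ℤ), Prime q →
      g CurveType.d + g CurveType.z = 1 → ¬ IsUnit (eval g q) →
      IsRelPrime q (X CurveType.d + X CurveType.z) := by
    intro q g hq h1 h0
    rw [hq.irreducible.isRelPrime_iff_not_dvd]
    intro h
    have := map_dvd (eval g) h
    rw [map_add, eval_X, eval_X, h1] at this
    exact h0 (isUnit_of_dvd_one this)
  have h2 : IsRelPrime (2 : MvPolynomial CurveType ℤ) (X CurveType.d + X CurveType.z) := by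
    have e : (2 : MvPolynomial CurveType ℤ) = C 2 := by simp
    refine key _ (fun t => match t with | .d => 1 | _ => 0) ?_ (by simp) ?_
    · rw [e, prime_C_iff]; exact Int.prime_two
    · rw [e, eval_C]; decide
  have hx : IsRelPrime (X CurveType.x : MvPolynomial CurveType ℤ)
      (X CurveType.d + X CurveType.z) := by
    refine key _ (fun t => match t with | .d => 1 | _ => 0) X_prime (by simp) ?_
    simp
  have hy : IsRelPrime (X CurveType.y : MvPolynomial CurveType ℤ)
      (X CurveType.d + X CurveType.z) := by
    refine key _ (fun t => match t with | .d => 1 | _ => 0) X_prime (by simp) ?_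
    simp
  intro r h3 h4
  refine h2.mul_left (hx.mul_left hy) ?_ h4
  have := dvd_sub (h4.mul_left (X CurveType.w)) h3
  rwa [sub_sub_cancel] at this

end KleinGram

namespace KleinGram

variable {n : ℕ}

/-! ### Deck transformations -/

theorem deck_injective (n : ℕ) : Function.Injective (deck n) := by
  rintro ⟨a, s⟩ ⟨b, t⟩ h
  simp only [deck, Prod.mk.injEq, Bool.not_eq_eq_eq_not, Bool.not_not, add_left_inj] at h
  exact Prod.ext h.1 h.2

/-- The deck transformation `deck n` as a permutation. -/
def deckPerm (n : ℕ) : Equiv.Perm StripPt where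
  toFun := deck n
  invFun p := (p.1 - n, !p.2)
  left_inv p := by simp [deck]
  right_inv p := by simp [deck]

@[simp] theorem deckPerm_apply (p : StripPt) : deckPerm n p = deck n p := rfl

theorem deckPerm_zpow_fst (k : ℤ) (p : StripPt) : ((deckPerm n ^ k) p).1 = p.1 + k * n := by
  induction k with
  | zero => simp
  | succ k ih => rw [add_comm, zpow_one_add, Equiv.Perm.mul_apply, deckPerm_apply, deck]; simp only [ih]; ring
  | pred k ih =>
    have e : (deckPerm n ^ (-(k : ℤ))) p = deck n ((deckPerm n ^ (-(k : ℤ) - 1)) p) := by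
      rw [← deckPerm_apply, ← Equiv.Perm.mul_apply, ← zpow_one_add]; congr 2; ring
    rw [e] at ih
    simp only [deck] at ih
    linarith

theorem deckPerm_zpow_two_mul (k : ℤ) (p : StripPt) :
    (deckPerm n ^ (2 * k)) p = (p.1 + k * (2 * n), p.2) := by
  have h1 := deckPerm_zpow_fst (n := n) (2 * k) p
  have h2 : ((deckPerm n ^ (2 * k)) p).2 = p.2 := by
    clear h1
    rw [zpow_mul]
    have e : ∀ q : StripPt, ((deckPerm n ^ (2 : ℤ)) q).2 = q.2 := by
      intro q
      rw [zpow_two, Equiv.Perm.mul_apply]; simp [deck]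
    induction k with
    | zero => simp
    | succ k ih => rw [add_comm, zpow_one_add, Equiv.Perm.mul_apply, e, ih]
    | pred k ih =>
      rw [← ih, show (-(k : ℤ)) = 1 + (-(k : ℤ) - 1) by ring, zpow_one_add, Equiv.Perm.mul_apply, e]
      simp
  exact Prod.ext (by rw [h1]; simp only; ring) h2

theorem deckPerm_zpow_eq_self [NeZero n] {k : ℤ} {p : StripPt} (h : (deckPerm n ^ k) p = p) :
    k = 0 := by
  have h1 := deckPerm_zpow_fst (n := n) k p
  rw [h] at h1
  have : (n : ℤ) ≠ 0 := by exact_mod_cast NeZero.ne n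
  have h2 : k * (n : ℤ) = 0 := by linarith
  exact (mul_eq_zero.1 h2).resolve_right this

theorem label_deck (p : StripPt) : label n (deck n p) = label n p := by
  obtain ⟨a, s⟩ := p
  cases s
  · simp only [label, deck, Bool.not_false, if_true, Bool.false_eq_true, if_false]
    have : ((a + n + n : ℤ) : ZMod (2 * n)) = ((a : ℤ) : ZMod (2 * n)) + ((2 * n : ℕ) : ZMod (2 * n)) := by
      push_cast; ring
    rw [this, ZMod.natCast_self, add_zero]
  · simp [label, deck]

theorem label_eq_iff {p q : StripPt} : label n p = label n q ↔ ∃ k : ℤ, q = (deckPerm n ^ k) p := by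
  constructor
  · intro h
    rw [label, label, ZMod.intCast_eq_intCast_iff_dvd_sub] at h
    obtain ⟨k, hk⟩ := h
    obtain ⟨a, s⟩ := p
    obtain ⟨b, t⟩ := q
    push_cast at hk
    cases s <;> cases t <;>
      simp only [Bool.false_eq_true, if_false, if_true] at hk
    · exact ⟨2 * k, by rw [deckPerm_zpow_two_mul]; exact Prod.ext (by simp only; linarith) rfl⟩
    · refine ⟨1 + 2 * (k - 1), ?_⟩
      rw [zpow_one_add, Equiv.Perm.mul_apply, deckPerm_zpow_two_mul, deckPerm_apply]
      exact Prod.ext (by simp only [deck]; linarith) rfl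
    · refine ⟨1 + 2 * k, ?_⟩
      rw [zpow_one_add, Equiv.Perm.mul_apply, deckPerm_zpow_two_mul, deckPerm_apply]
      exact Prod.ext (by simp only [deck]; linarith) rfl
    · exact ⟨2 * k, by rw [deckPerm_zpow_two_mul]; exact Prod.ext (by simp only; linarith) rfl⟩
  · rintro ⟨k, rfl⟩
    induction k with
    | zero => simp
    | succ k ih =>
      rw [ih, add_comm, zpow_one_add, Equiv.Perm.mul_apply, deckPerm_apply, label_deck]
    | pred k ih =>
      rw [ih, show (-(k : ℤ)) = 1 + (-(k : ℤ) - 1) by ring, zpow_one_add, Equiv.Perm.mul_apply,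
        deckPerm_apply, label_deck]
      simp

theorem label_zpow (k : ℤ) (p : StripPt) : label n ((deckPerm n ^ k) p) = label n p :=
  (label_eq_iff.2 ⟨k, rfl⟩).symm

theorem label_surjective [NeZero n] (i : ZMod (2 * n)) : ∃ p, label n p = i := by
  obtain ⟨k, hk⟩ := ZMod.intCast_surjective i
  exact ⟨(k, false), by simpa [label] using hk⟩

/-! ### The order on the boundary of the strip -/

theorem Before.irrefl (p : StripPt) : ¬ Before p p := by
  obtain ⟨a, s⟩ := p; cases s <;> simp [Before]

theorem Before.trans {p q r : StripPt} (h : Before p q) (h' : Before q r) : Before p r := by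
  obtain ⟨a, s⟩ := p; obtain ⟨b, t⟩ := q; obtain ⟨c, u⟩ := r
  cases s <;> cases t <;> cases u <;> simp only [Before] at * <;> omega

theorem Before.trichotomy (p q : StripPt) : Before p q ∨ p = q ∨ Before q p := by
  obtain ⟨a, s⟩ := p; obtain ⟨b, t⟩ := q
  cases s <;> cases t <;> simp only [Before, Prod.mk.injEq, and_true, true_or,
    or_true] <;> omega

theorem Before.asymm {p q : StripPt} (h : Before p q) : ¬ Before q p :=
  fun h' => Before.irrefl p (h.trans h')

/-- The mate function of a connection as a permutation. -/
def Connection.matePerm (m : Connection n) : Equiv.Perm StripPt :=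
  ⟨m.mate, m.mate, m.mate_mate, m.mate_mate⟩

@[simp] theorem Connection.matePerm_apply (m : Connection n) (p : StripPt) :
    m.matePerm p = m.mate p := rfl

theorem Connection.mate_zpow (m : Connection n) (k : ℤ) (p : StripPt) :
    m.mate ((deckPerm n ^ k) p) = (deckPerm n ^ k) (m.mate p) := by
  have : Commute m.matePerm (deckPerm n) := Equiv.ext fun p => m.mate_deck p
  exact congrArg (fun e : Equiv.Perm StripPt => e p) (this.zpow_right k)

/-- Whether an arc crosses the crosscap can be read off from any one of its lifts. -/
theorem Connection.crosses_label (m : Connection n) (p : StripPt) :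
    m.Crosses (label n p) ↔ (m.mate p).2 ≠ p.2 := by
  constructor
  · rintro ⟨q, hq, hne⟩
    obtain ⟨k, rfl⟩ := label_eq_iff.1 hq
    rw [m.mate_zpow]
    have key : ∀ (k : ℤ) (x y : StripPt), x.2 ≠ y.2 →
        ((deckPerm n ^ k) x).2 ≠ ((deckPerm n ^ k) y).2 := by
      intro k x y hxy
      rcases Int.even_or_odd' k with ⟨l, rfl | rfl⟩
      · rwa [deckPerm_zpow_two_mul, deckPerm_zpow_two_mul]
      · rw [add_comm, zpow_one_add, Equiv.Perm.mul_apply, Equiv.Perm.mul_apply,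
          deckPerm_zpow_two_mul, deckPerm_zpow_two_mul]
        simpa [deck] using hxy
    exact key k _ _ hne
  · exact fun h => ⟨p, rfl, h⟩

theorem Connection.joins_iff (m : Connection n) (p : StripPt) (j : ZMod (2 * n)) :
    m.Joins (label n p) j ↔ label n (m.mate p) = j := by
  constructor
  · rintro ⟨q, hq, rfl⟩
    obtain ⟨k, rfl⟩ := label_eq_iff.1 hq
    rw [m.mate_zpow, label_zpow]
  · exact fun h => ⟨p, rfl, h⟩

/-! ### Inserting a connection of two marked points into a system of arcs -/

namespace CupSystem

variable (C : CupSystem n)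

/-- The arcs in the strip, on both boundary lines. -/
def cupS : StripPt → StripPt
  | (i, false) => (C.cup i, false)
  | (i, true) => (C.cup (i - n) + n, true)

/-- The lifts of the two free points in the strip, on both boundary lines. -/
def freeS : StripPt → StripPt
  | (i, false) => (C.free i, false)
  | (i, true) => (C.free (i - 1) + n, true)

theorem cupS_snd (p : StripPt) : (C.cupS p).2 = p.2 := by
  obtain ⟨i, s⟩ := p; cases s <;> rfl

theorem freeS_snd (p : StripPt) : (C.freeS p).2 = p.2 := by
  obtain ⟨i, s⟩ := p; cases s <;> rfl

theorem cupS_cupS (p : StripPt) : C.cupS (C.cupS p) = p := by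
  obtain ⟨i, s⟩ := p; cases s <;> simp [cupS, C.cup_cup]

theorem cupS_deck (p : StripPt) : C.cupS (deck n p) = deck n (C.cupS p) := by
  obtain ⟨i, s⟩ := p
  cases s
  · simp [cupS, deck]
  · have := C.cup_add (i - n)
    rw [show i - n + 2 * (n : ℤ) = i + n by ring] at this
    simp only [deck, cupS, Bool.not_true, this]
    exact Prod.ext (by simp only; ring) rfl

/-- The free points behave like the marked points of a band with n = 1; the index `i - 1` on the
upper line in `freeS` is chosen to make this equivariance hold. -/
theorem freeS_deck (p : StripPt) : C.freeS (deck 1 p) = deck n (C.freeS p) := by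
  obtain ⟨i, s⟩ := p
  cases s
  · simp [freeS, deck]
  · have := C.free_add_two (i - 1)
    rw [show i - 1 + 2 = i + 1 by ring] at this
    simp only [deck, freeS, Bool.not_true, Nat.cast_one, this]
    exact Prod.ext (by simp only; ring) rfl

theorem freeS_injective : Function.Injective C.freeS := by
  rintro ⟨i, s⟩ ⟨j, t⟩ h
  cases s <;> cases t <;> simp only [freeS, Prod.mk.injEq, and_true, and_false, reduceCtorEq,
    C.free_strictMono.injective.eq_iff, add_left_inj, sub_left_inj] at h
  · exact Prod.ext h rfl
  · exact Prod.ext h rfl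

theorem before_freeS_iff (p q : StripPt) : Before (C.freeS p) (C.freeS q) ↔ Before p q := by
  obtain ⟨i, s⟩ := p; obtain ⟨j, t⟩ := q
  cases s <;> cases t <;> simp [freeS, Before, C.free_strictMono.lt_iff_lt]

theorem cupS_eq_self_iff (p : StripPt) : C.cupS p = p ↔ ∃ x, C.freeS x = p := by
  obtain ⟨i, s⟩ := p
  cases s
  · simp only [cupS, Prod.mk.injEq, and_true, C.cup_eq_self]
    constructor
    · rintro ⟨k, rfl⟩; exact ⟨(k, false), rfl⟩
    · rintro ⟨⟨k, s⟩, hk⟩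
      cases s <;> simp only [freeS, Prod.mk.injEq, reduceCtorEq, and_false, and_true] at hk
      exact ⟨k, hk⟩
  · have : C.cup (i - n) + n = i ↔ C.cup (i - n) = i - n := by constructor <;> intro h <;> linarith
    simp only [cupS, Prod.mk.injEq, and_true, this, C.cup_eq_self]
    constructor
    · rintro ⟨k, hk⟩
      exact ⟨(k + 1, true), by simp [freeS, hk]⟩
    · rintro ⟨⟨k, s⟩, hk⟩
      cases s <;> simp only [freeS, Prod.mk.injEq, reduceCtorEq, and_false, and_true] at hk
      exact ⟨k - 1, by linarith⟩

theorem cupS_freeS (x : StripPt) : C.cupS (C.freeS x) = C.freeS x :=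
  (C.cupS_eq_self_iff _).2 ⟨x, rfl⟩

theorem cupS_noncrossing (p q : StripPt) :
    ¬ (Before p q ∧ Before q (C.cupS p) ∧ Before (C.cupS p) (C.cupS q)) := by
  rintro ⟨h1, h2, h3⟩
  obtain ⟨i, s⟩ := p; obtain ⟨j, t⟩ := q
  cases s <;> cases t <;> simp only [Before, cupS] at h1 h2 h3
  · exact C.noncrossing i j ⟨h1, h2, h3⟩
  -- The upper line is traversed backwards, so the two arcs exchange roles and are read from their
  -- other ends.
  · refine C.noncrossing (C.cup (j - n)) (C.cup (i - n)) ⟨by omega, ?_, ?_⟩ <;>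
      simp only [C.cup_cup] <;> omega

theorem freeS_uncovered (p x : StripPt) :
    ¬ (Before p (C.freeS x) ∧ Before (C.freeS x) (C.cupS p)) := by
  rintro ⟨h1, h2⟩
  obtain ⟨i, s⟩ := p; obtain ⟨j, t⟩ := x
  cases s <;> cases t <;> simp only [Before, cupS, freeS] at h1 h2
  · exact C.uncovered i j ⟨h1, h2⟩
  · refine C.uncovered (C.cup (i - n)) (j - 1) ⟨by omega, ?_⟩
    simp only [C.cup_cup]; omega

open Classical in
noncomputable def insertMate (u : Connection 1) (p : StripPt) : StripPt :=
  if h : ∃ x, C.freeS x = p then C.freeS (u.mate h.choose) else C.cupS p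

theorem insertMate_freeS (u : Connection 1) (x : StripPt) :
    C.insertMate u (C.freeS x) = C.freeS (u.mate x) := by
  have h : ∃ y, C.freeS y = C.freeS x := ⟨x, rfl⟩
  rw [insertMate, dif_pos h, C.freeS_injective h.choose_spec]

theorem insertMate_of_ne (u : Connection 1) {p : StripPt} (hp : C.cupS p ≠ p) :
    C.insertMate u p = C.cupS p := by
  rw [insertMate, dif_neg (mt (C.cupS_eq_self_iff p).2 hp)]

theorem free_or_cup (p : StripPt) : (∃ x, p = C.freeS x) ∨ C.cupS p ≠ p := by
  by_cases h : C.cupS p = p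
  · obtain ⟨x, rfl⟩ := (C.cupS_eq_self_iff p).1 h; exact Or.inl ⟨x, rfl⟩
  · exact Or.inr h

theorem cupS_ne {p : StripPt} (h : C.cupS p ≠ p) : C.cupS (C.cupS p) ≠ C.cupS p := by
  rw [C.cupS_cupS]; exact h.symm

/-- The connection consisting of the arcs of `C` and of one more arc that joins the free points
as in `u`. -/
noncomputable def insert (u : Connection 1) : Connection n where
  mate := C.insertMate u
  mate_mate p := by
    rcases C.free_or_cup p with ⟨x, rfl⟩ | h
    · rw [C.insertMate_freeS, C.insertMate_freeS, u.mate_mate]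
    · rw [C.insertMate_of_ne u h, C.insertMate_of_ne u (C.cupS_ne h), C.cupS_cupS]
  mate_ne p := by
    rcases C.free_or_cup p with ⟨x, rfl⟩ | h
    · rw [C.insertMate_freeS, C.freeS_injective.ne_iff]; exact u.mate_ne x
    · rwa [C.insertMate_of_ne u h]
  mate_deck p := by
    rcases C.free_or_cup p with ⟨x, rfl⟩ | h
    · rw [C.insertMate_freeS, ← C.freeS_deck, C.insertMate_freeS, u.mate_deck, C.freeS_deck]
    · rw [C.insertMate_of_ne u h, C.insertMate_of_ne u, C.cupS_deck]
      rw [C.cupS_deck]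
      exact (deck_injective n).ne h
  noncrossing p q := by
    rcases C.free_or_cup p with ⟨x, rfl⟩ | hp <;> rcases C.free_or_cup q with ⟨y, rfl⟩ | hq
    · simp only [C.insertMate_freeS, C.before_freeS_iff]
      exact u.noncrossing x y
    · simp only [C.insertMate_freeS, C.insertMate_of_ne u hq]
      exact fun h => C.freeS_uncovered q _ h.2
    · simp only [C.insertMate_freeS, C.insertMate_of_ne u hp]
      exact fun h => C.freeS_uncovered p _ ⟨h.1, h.2.1⟩
    · simp only [C.insertMate_of_ne u hp, C.insertMate_of_ne u hq]
      exact C.cupS_noncrossing p q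

theorem insert_mate_freeS (u : Connection 1) (x : StripPt) :
    (C.insert u).mate (C.freeS x) = C.freeS (u.mate x) := C.insertMate_freeS u x

theorem insert_mate_of_ne (u : Connection 1) {p : StripPt} (hp : C.cupS p ≠ p) :
    (C.insert u).mate p = C.cupS p := C.insertMate_of_ne u hp

end CupSystem

/-- The arc of two marked points that crosses the crosscap. -/
def crossArc : Connection 1 where
  mate p := (p.1, !p.2)
  mate_mate p := by simp
  mate_ne p := by simp [Prod.ext_iff]
  mate_deck p := by simp [deck]
  noncrossing := by
    rintro ⟨i, s⟩ ⟨j, t⟩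
    cases s <;> cases t <;> (simp [Before]; try omega)

/-- The arcs of two marked points that can be isotoped off the crosscap: the one that joins the
lifts `2 * k` and `2 * k + 1` of the line `t = 0` for `b = false`, and the one that joins the lifts
`2 * k` and `2 * k - 1` for `b = true`. -/
def sideArc (b : Bool) : Connection 1 where
  mate p := (if Even p.1 ↔ p.2 = b then p.1 + 1 else p.1 - 1, p.2)
  mate_mate := by
    rintro ⟨i, s⟩
    by_cases he : Even i <;> cases s <;> cases b <;> simp [he, parity_simps]
  mate_ne := by
    rintro ⟨i, s⟩
    simp only [ne_eq, Prod.mk.injEq, and_true]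
    split_ifs <;> omega
  mate_deck := by
    rintro ⟨i, s⟩
    by_cases he : Even i <;> cases s <;> cases b <;>
      simp [he, deck, parity_simps]
  noncrossing := by
    rintro ⟨i, s⟩ ⟨j, t⟩ ⟨h1, h2, -⟩
    cases s <;> cases t <;> simp only [Before] at h1 h2 <;> split_ifs at h2 <;> omega

end KleinGram

/-! ### Parity arguments and the lifted strand between the free points -/

namespace KleinGram

variable {n : ℕ}

theorem even_card_filter_ne {α : Type*} [DecidableEq α] (A : Finset α) (g : α → α)
    (hg : ∀ x, g (g x) = x) (hA : ∀ x ∈ A, g x ∈ A) : Even (A.filter fun x => g x ≠ x).card := by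
  have h : ∑ x ∈ A.filter (fun x => g x ≠ x), (1 : ZMod 2) = 0 := by
    refine Finset.sum_involution (fun x _ => g x) (fun _ _ => by decide) ?_ ?_ ?_
    · exact fun x hx _ => (Finset.mem_filter.1 hx).2
    · intro x hx
      have hx := Finset.mem_filter.1 hx
      exact Finset.mem_filter.2 ⟨hA x hx.1, by rw [hg]; exact hx.2.symm⟩
    · exact fun x _ => hg x
  rw [Finset.sum_const, nsmul_eq_mul, mul_one, ZMod.natCast_eq_zero_iff] at h
  exact even_iff_two_dvd.2 h

theorem card_filter_before_add {A : Finset StripPt} {x y : StripPt} (hx : x ∉ A)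
    (hxy : Before x y) [DecidablePred fun z => Before z x] [DecidablePred fun z => Before z y]
    [DecidablePred fun z => Before x z ∧ Before z y] :
    (A.filter fun z => Before z y).card =
      (A.filter fun z => Before z x).card + (A.filter fun z => Before x z ∧ Before z y).card := by
  classical
  rw [← Finset.card_union_of_disjoint]
  · congr 1
    ext z
    simp only [Finset.mem_filter, Finset.mem_union, ← and_or_left, and_congr_right_iff]
    intro hz
    constructor
    · intro h
      rcases Before.trichotomy z x with h1 | rfl | h1
      · exact Or.inl h1
      · exact absurd hz hx
      · exact Or.inr ⟨h1, h⟩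
    · rintro (h | h)
      · exact h.trans hxy
      · exact h.2
  · rw [Finset.disjoint_filter]
    exact fun z _ h h' => h.asymm h'.1

open Classical in
/-- If the arcs `{x, g x}` are noncrossing, then the two sides of a closed curve made of such arcs
are not connected by any other such arc. -/
theorem even_card_before_iff (A : Finset StripPt) (g : StripPt → StripPt)
    (hg : ∀ x, g (g x) = x) (hA : ∀ x ∈ A, g x ∈ A)
    (nc : ∀ p q, ¬ (Before p q ∧ Before q (g p) ∧ Before (g p) (g q)))
    (hfix : ∀ x y, Before x y → Before y (g x) → g y ≠ y) {x : StripPt} (hx : x ∉ A) :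
    Even (A.filter fun z => Before z (g x)).card ↔ Even (A.filter fun z => Before z x).card := by
  have key : ∀ x, x ∉ A → Before x (g x) →
      (Even (A.filter fun z => Before z (g x)).card ↔
        Even (A.filter fun z => Before z x).card) := by
    intro x hx hlt
    -- By noncrossing, `g` preserves the points of `A` under the arc from `x` to `g x`, and it fixes
    -- none of them, so they pair off.
    have hev : Even (A.filter fun z => Before x z ∧ Before z (g x)).card := by
      have h := even_card_filter_ne (A.filter fun z => Before x z ∧ Before z (g x)) g hg ?_
      · rwa [Finset.filter_true_of_mem] at h
        intro z hz
        have hz := Finset.mem_filter.1 hz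
        exact hfix x z hz.2.1 hz.2.2
      · intro z hz
        obtain ⟨hzA, h1, h2⟩ := Finset.mem_filter.1 hz
        refine Finset.mem_filter.2 ⟨hA z hzA, ?_, ?_⟩
        · rcases Before.trichotomy x (g z) with h | h | h
          · exact h
          · rw [h, hg] at h2; exact absurd h2 (Before.irrefl z)
          · exact absurd ⟨h, by rwa [hg], by rwa [hg]⟩ (nc (g z) x)
        · rcases Before.trichotomy (g z) (g x) with h | h | h
          · exact h
          · rw [← hg z, h, hg] at h1; exact absurd h1 (Before.irrefl x)
          · exact absurd ⟨h1, h2, h⟩ (nc x z)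
    rw [card_filter_before_add hx hlt, Nat.even_add]
    simp [hev]
  rcases Before.trichotomy x (g x) with h | h | h
  · exact key x hx h
  · rw [← h]
  · have h1 : g x ∉ A := fun h2 => hx (by rw [← hg x]; exact hA _ h2)
    have := key (g x) h1 (by rwa [hg])
    rw [hg] at this
    exact this.symm

/-- If the mate were the translate by the k-th deck transformation, applying `mate` twice would make
the 2k-th one fix `p`; deck transformations act freely, so k = 0, contradicting `mate_ne`. -/
theorem Connection.label_mate_ne [NeZero n] (m : Connection n) (p : StripPt) :
    label n (m.mate p) ≠ label n p := by
  intro h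
  obtain ⟨k, hk⟩ := label_eq_iff.1 h.symm
  have h1 := m.mate_zpow k p
  rw [← hk, m.mate_mate, hk, ← Equiv.Perm.mul_apply, ← zpow_add] at h1
  have h2 := deckPerm_zpow_eq_self h1.symm
  have h3 : k = 0 := by omega
  subst h3
  exact m.mate_ne p (by simpa using hk)

namespace CupSystem

variable (C : CupSystem n) (m : Connection n)

theorem freeS_zpow (k : ℤ) (x : StripPt) :
    C.freeS ((deckPerm 1 ^ k) x) = (deckPerm n ^ k) (C.freeS x) := by
  induction k with
  | zero => simp
  | succ k ih =>
    rw [add_comm, zpow_one_add, zpow_one_add, Equiv.Perm.mul_apply, Equiv.Perm.mul_apply,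
      deckPerm_apply, deckPerm_apply, C.freeS_deck, ih]
  | pred k ih =>
    rw [show (-(k : ℤ)) = 1 + (-(k : ℤ) - 1) by ring, zpow_one_add, zpow_one_add,
      Equiv.Perm.mul_apply, Equiv.Perm.mul_apply, deckPerm_apply, deckPerm_apply, C.freeS_deck] at ih
    exact deck_injective n ih

theorem label_freeS {x y : StripPt} (h : label 1 x = label 1 y) :
    label n (C.freeS x) = label n (C.freeS y) := by
  obtain ⟨k, rfl⟩ := label_eq_iff.1 h
  rw [C.freeS_zpow, label_zpow]

/-- The arcs of `C` as a permutation of the lifts. -/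
def cupPerm : Equiv.Perm StripPt := ⟨C.cupS, C.cupS, C.cupS_cupS, C.cupS_cupS⟩

@[simp] theorem cupPerm_apply (p : StripPt) : C.cupPerm p = C.cupS p := rfl

theorem cupS_zpow (k : ℤ) (p : StripPt) :
    C.cupS ((deckPerm n ^ k) p) = (deckPerm n ^ k) (C.cupS p) := by
  have : Commute C.cupPerm (deckPerm n) := Equiv.ext fun p => C.cupS_deck p
  exact congrArg (fun e : Equiv.Perm StripPt => e p) (this.zpow_right k)

/-- The lift of the first free point. -/
def base : StripPt := C.freeS (0, false)

theorem cupS_base : C.cupS C.base = C.base := C.cupS_freeS _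

theorem cupS_eq_self_cases {x : StripPt} (hx : C.cupS x = x) :
    (∃ k : ℤ, x = (deckPerm n ^ k) C.base) ∨ ∃ k : ℤ, x = (deckPerm n ^ k) (C.freeS (1, false)) := by
  obtain ⟨y, rfl⟩ := (C.cupS_eq_self_iff x).1 hx
  have h : ∀ a : ZMod (2 * 1), label 1 (0, false) = a ∨ label 1 (1, false) = a := by
    simp only [label]; decide
  rcases h (label 1 y) with h | h
  · obtain ⟨k, rfl⟩ := label_eq_iff.1 h
    exact Or.inl ⟨k, C.freeS_zpow k _⟩
  · obtain ⟨k, rfl⟩ := label_eq_iff.1 h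
    exact Or.inr ⟨k, C.freeS_zpow k _⟩

/-- The lift, starting at the first free point, of the strand formed by the arcs of `C` in the
inner and those of `m` in the outer Moebius band. -/
def strand : Set StripPt := {x | ∃ i : ℤ, x = ((C.cupPerm * m.matePerm) ^ i) C.base}

theorem base_mem_strand : C.base ∈ C.strand m := ⟨0, rfl⟩

/-- An involution conjugates its product with another involution to the inverse product, and `base`
is fixed by the arcs of `C`. -/
theorem cupS_strand_zpow (i : ℤ) : C.cupS (((C.cupPerm * m.matePerm) ^ i) C.base) =
    ((C.cupPerm * m.matePerm) ^ (-i)) C.base := by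
  have hF : C.cupPerm⁻¹ = C.cupPerm := rfl
  have hT : m.matePerm⁻¹ = m.matePerm := rfl
  have h1 : C.cupPerm * (C.cupPerm * m.matePerm) * C.cupPerm⁻¹ = (C.cupPerm * m.matePerm)⁻¹ := by
    rw [mul_inv_rev, hT, ← mul_assoc]
    nth_rewrite 1 [← hF]
    rw [inv_mul_cancel, one_mul, hF]
  have h2 := conj_zpow (a := C.cupPerm) (b := C.cupPerm * m.matePerm) (i := i)
  rw [h1, inv_zpow'] at h2
  rw [h2, hF, Equiv.Perm.mul_apply, Equiv.Perm.mul_apply, cupPerm_apply, cupPerm_apply,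
    C.cupS_base]

theorem cupS_mem_strand {x : StripPt} (hx : x ∈ C.strand m) : C.cupS x ∈ C.strand m := by
  obtain ⟨i, rfl⟩ := hx
  exact ⟨-i, C.cupS_strand_zpow m i⟩

theorem mate_mem_strand {x : StripPt} (hx : x ∈ C.strand m) : m.mate x ∈ C.strand m := by
  obtain ⟨i, rfl⟩ := hx
  have h : C.cupS (((C.cupPerm * m.matePerm) ^ (1 + i)) C.base) ∈ C.strand m :=
    C.cupS_mem_strand m ⟨_, rfl⟩
  rwa [zpow_one_add, Equiv.Perm.mul_apply, Equiv.Perm.mul_apply, cupPerm_apply, C.cupS_cupS] at h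

theorem cupS_mem_strand_iff {x : StripPt} : C.cupS x ∈ C.strand m ↔ x ∈ C.strand m :=
  ⟨fun h => by rw [← C.cupS_cupS x]; exact C.cupS_mem_strand m h, C.cupS_mem_strand m⟩

theorem mate_mem_strand_iff {x : StripPt} : m.mate x ∈ C.strand m ↔ x ∈ C.strand m :=
  ⟨fun h => by rw [← m.mate_mate x]; exact C.mate_mem_strand m h, C.mate_mem_strand m⟩

/-- Stated for an arbitrary translate of the strand, which is possible because both involutions
commute with the deck transformations. -/
theorem strand_induction {B : Set StripPt} (h1 : ∀ x ∈ B, C.cupS x ∈ B)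
    (h2 : ∀ x ∈ B, m.mate x ∈ B) {k : ℤ} (h3 : (deckPerm n ^ k) C.base ∈ B) :
    ∀ x ∈ C.strand m, (deckPerm n ^ k) x ∈ B := by
  rintro x ⟨i, rfl⟩
  induction i with
  | zero => simpa using h3
  | succ i ih =>
    rw [add_comm, zpow_one_add, Equiv.Perm.mul_apply, Equiv.Perm.mul_apply, cupPerm_apply,
      Connection.matePerm_apply, ← C.cupS_zpow, ← m.mate_zpow]
    exact h1 _ (h2 _ ih)
  | pred i ih =>
    rw [show (-(i : ℤ)) = 1 + (-(i : ℤ) - 1) by ring, zpow_one_add, Equiv.Perm.mul_apply,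
      Equiv.Perm.mul_apply, cupPerm_apply, Connection.matePerm_apply, ← C.cupS_zpow,
      ← m.mate_zpow] at ih
    have := h2 _ (h1 _ ih)
    rwa [C.cupS_cupS, m.mate_mate] at this

variable [NeZero n]

/-- Distinct translates of the strand are disjoint. If the k-th translate of `base` is a power of
the product applied to `base`, then reflecting by `cupS` shows that the inverse power gives the same
point, so the 2k-th translate is `base` itself. -/
theorem strand_zpow_eq_zero {x : StripPt} (hx : x ∈ C.strand m) {k : ℤ}
    (hk : (deckPerm n ^ k) x ∈ C.strand m) : k = 0 := by
  have hc : Commute (deckPerm n) (C.cupPerm * m.matePerm) := by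
    refine Equiv.ext fun p => ?_
    simp [m.mate_deck, C.cupS_deck]
  obtain ⟨i, rfl⟩ := hx
  obtain ⟨j, hj⟩ := hk
  have h1 : (deckPerm n ^ k) C.base = ((C.cupPerm * m.matePerm) ^ (j - i)) C.base := by
    rw [← Equiv.Perm.mul_apply, (hc.zpow_zpow k i).eq, Equiv.Perm.mul_apply] at hj
    rw [sub_eq_neg_add, zpow_add, Equiv.Perm.mul_apply, ← hj, ← Equiv.Perm.mul_apply,
      ← zpow_add, neg_add_cancel, zpow_zero, Equiv.Perm.one_apply]
  have h2 := C.cupS_strand_zpow m (j - i)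
  rw [← h1, C.cupS_zpow, C.cupS_base] at h2
  have h3 : (deckPerm n ^ (k + k)) C.base = C.base := by
    rw [zpow_add, Equiv.Perm.mul_apply, h2, ← Equiv.Perm.mul_apply, (hc.zpow_zpow k _).eq,
      Equiv.Perm.mul_apply, h1, ← Equiv.Perm.mul_apply, ← zpow_add, neg_add_cancel, zpow_zero,
      Equiv.Perm.one_apply]
  have := deckPerm_zpow_eq_self h3
  omega

theorem label_injOn_strand : Set.InjOn (label n) (C.strand m) := by
  intro x hx y hy h
  obtain ⟨k, rfl⟩ := label_eq_iff.1 h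
  have := C.strand_zpow_eq_zero m hx hy
  subst this
  simp

theorem strand_finite : (C.strand m).Finite := by
  have : NeZero (2 * n) := ⟨mul_ne_zero two_ne_zero (NeZero.ne n)⟩
  exact Set.Finite.of_injOn (fun _ _ => Set.mem_univ _) (C.label_injOn_strand m) Set.finite_univ

noncomputable def strandFinset : Finset StripPt := (C.strand_finite m).toFinset

@[simp] theorem mem_strandFinset {x : StripPt} : x ∈ C.strandFinset m ↔ x ∈ C.strand m := by
  simp [strandFinset]

theorem cupS_mem_strandFinset : ∀ x ∈ C.strandFinset m, C.cupS x ∈ C.strandFinset m :=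
  fun _ hx => (C.mem_strandFinset m).2 (C.cupS_mem_strand m ((C.mem_strandFinset m).1 hx))

theorem mate_mem_strandFinset : ∀ x ∈ C.strandFinset m, m.mate x ∈ C.strandFinset m :=
  fun _ hx => (C.mem_strandFinset m).2 (C.mate_mem_strand m ((C.mem_strandFinset m).1 hx))

/-- `m` pairs off all points of the strand and `C` all but the free ones, so the number of free
points is even. Each of the two orbits of free points meets the strand at most once, hence there is
exactly one end besides `base`. -/
theorem exists_strand_end : ∃ k : ℤ, (deckPerm n ^ k) (C.freeS (1, false)) ∈ C.strand m ∧
    ∀ x ∈ C.strand m, C.cupS x = x →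
      x = C.base ∨ x = (deckPerm n ^ k) (C.freeS (1, false)) := by
  classical
  have e1 := even_card_filter_ne (C.strandFinset m) m.mate m.mate_mate
    (C.mate_mem_strandFinset m)
  rw [Finset.filter_true_of_mem (fun x _ => m.mate_ne x)] at e1
  have e2 := even_card_filter_ne (C.strandFinset m) C.cupS C.cupS_cupS
    (C.cupS_mem_strandFinset m)
  rw [← Finset.card_filter_add_card_filter_not (fun x => C.cupS x = x), Nat.even_add] at e1
  have e3 := e1.2 e2
  have hb : C.base ∈ (C.strandFinset m).filter fun x => C.cupS x = x := by
    simp [C.base_mem_strand, C.cupS_base]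
  have h1 : 1 < ((C.strandFinset m).filter fun x => C.cupS x = x).card := by
    have := Finset.card_pos.2 ⟨_, hb⟩
    obtain ⟨r, hr⟩ := e3
    omega
  obtain ⟨q, hq, hne⟩ := Finset.exists_mem_ne h1 C.base
  simp only [Finset.mem_filter, mem_strandFinset] at hq
  have key : ∀ x ∈ C.strand m, C.cupS x = x → x ≠ C.base →
      ∃ k : ℤ, x = (deckPerm n ^ k) (C.freeS (1, false)) := by
    intro x hx hfix hxb
    rcases C.cupS_eq_self_cases hfix with ⟨k, rfl⟩ | h
    · have := C.strand_zpow_eq_zero m (C.base_mem_strand m) hx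
      subst this
      simp at hxb
    · exact h
  obtain ⟨k, rfl⟩ := key q hq.1 hq.2 hne
  refine ⟨k, hq.1, fun x hx hfix => ?_⟩
  by_cases hxb : x = C.base
  · exact Or.inl hxb
  · obtain ⟨l, rfl⟩ := key x hx hfix hxb
    refine Or.inr (C.label_injOn_strand m hx hq.1 ?_)
    rw [label_zpow, label_zpow]

/-- A strand that returns to the same line joins neighbouring free points. -/
theorem strand_ends_le {a b : ℤ} (ha : C.freeS (a, false) ∈ C.strand m)
    (hb : C.freeS (b, false) ∈ C.strand m)
    (hab : ∀ x ∈ C.strand m, C.cupS x = x → x = C.freeS (a, false) ∨ x = C.freeS (b, false)) :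
    b ≤ a + 2 := by
  classical
  by_contra hlt
  push Not at hlt
  let A := C.strandFinset m
  -- The points off the strand on the same side of it as the translate of `base` by one period;
  -- parity of the number of preceding strand points records the side. The translated strand avoids
  -- the strand, so it stays in `B`.
  let B : Set StripPt := {x | x ∉ C.strand m ∧ (Even (A.filter fun z => Before z x).card ↔
    Even (A.filter fun z => Before z ((deckPerm n ^ (2 : ℤ)) C.base)).card)}
  have hB : ∀ x ∈ C.strand m, (deckPerm n ^ (2 : ℤ)) x ∈ B := by
    refine C.strand_induction m ?_ ?_ ⟨?_, Iff.rfl⟩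
    · rintro x ⟨hx, hx'⟩
      refine ⟨mt (C.cupS_mem_strand_iff m).1 hx, ?_⟩
      rw [← hx']
      refine even_card_before_iff A C.cupS C.cupS_cupS ?_ C.cupS_noncrossing ?_ (by simpa [A] using hx)
      · exact C.cupS_mem_strandFinset m
      · intro p q h1 h2 h3
        obtain ⟨y, rfl⟩ := (C.cupS_eq_self_iff q).1 h3
        exact C.freeS_uncovered p y ⟨h1, h2⟩
    · rintro x ⟨hx, hx'⟩
      refine ⟨mt (C.mate_mem_strand_iff m).1 hx, ?_⟩
      rw [← hx']
      refine even_card_before_iff A m.mate m.mate_mate ?_ m.noncrossing ?_ (by simpa [A] using hx)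
      · exact C.mate_mem_strandFinset m
      · exact fun _ y _ _ => m.mate_ne y
    · intro h
      have := C.strand_zpow_eq_zero m (C.base_mem_strand m) h
      omega
  have hs : ∀ i : ℤ, (deckPerm n ^ (2 : ℤ)) (C.freeS (i, false)) = C.freeS (i + 2, false) := by
    intro i
    rw [← C.freeS_zpow, show (2 : ℤ) = 2 * 1 by ring, deckPerm_zpow_two_mul]
    simp
  have h1 := hB _ ha
  have h2 := hB _ hb
  rw [hs] at h1 h2
  have h3 := h2.2.trans h1.2.symm
  have hord : Before (C.freeS (a + 2, false)) (C.freeS (b + 2, false)) := by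
    rw [C.before_freeS_iff]; simp only [Before]; omega
  rw [card_filter_before_add (by simpa [A] using h1.1) hord, Nat.even_add] at h3
  set E := A.filter fun z => Before (C.freeS (a + 2, false)) z ∧ Before z (C.freeS (b + 2, false))
  have hE : Even E.card := by tauto
  have hEF : ∀ x ∈ E, C.cupS x ∈ E := by
    intro x hx
    obtain ⟨hxA, h4, h5⟩ := Finset.mem_filter.1 hx
    refine Finset.mem_filter.2 ⟨?_, ?_, ?_⟩
    · exact (C.mem_strandFinset m).2 (C.cupS_mem_strand m ((C.mem_strandFinset m).1 hxA))
    · rcases Before.trichotomy (C.freeS (a + 2, false)) (C.cupS x) with h | h | h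
      · exact h
      · have := C.cupS_freeS (a + 2, false)
        rw [h, C.cupS_cupS] at this
        rw [h, ← this] at h4
        exact absurd h4 (Before.irrefl _)
      · exact absurd ⟨h, by rwa [C.cupS_cupS]⟩ (C.freeS_uncovered (C.cupS x) (a + 2, false))
    · rcases Before.trichotomy (C.cupS x) (C.freeS (b + 2, false)) with h | h | h
      · exact h
      · have := C.cupS_freeS (b + 2, false)
        rw [← h, C.cupS_cupS] at this
        rw [← h, ← this] at h5
        exact absurd h5 (Before.irrefl _)
      · exact absurd ⟨h5, h⟩ (C.freeS_uncovered x (b + 2, false))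
  have h6 := even_card_filter_ne E C.cupS C.cupS_cupS hEF
  rw [← Finset.card_filter_add_card_filter_not (fun x => C.cupS x = x), Nat.even_add] at hE
  have h7 := hE.2 h6
  -- If `b > a + 2`, exactly one end of the strand lies between the ends of its translate,
  -- contradicting the even count in `h7`.
  have h8 : (E.filter fun x => C.cupS x = x) = {C.freeS (b, false)} := by
    ext x
    simp only [Finset.mem_filter, Finset.mem_singleton, E, A, mem_strandFinset]
    constructor
    · rintro ⟨⟨hx, h4, -⟩, hfix⟩
      rcases hab x hx hfix with rfl | rfl
      · rw [C.before_freeS_iff] at h4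
        simp only [Before] at h4
        omega
      · rfl
    · rintro rfl
      rw [C.before_freeS_iff, C.before_freeS_iff]
      simp only [Before]
      exact ⟨⟨hb, by omega, by omega⟩, C.cupS_freeS _⟩
  rw [h8] at h7
  simp at h7

-- Strand points on the upper line are counted modulo 2 in two ways. Arcs of `C` stay on a line, so
-- only `Q` can be left over, `base` being on the lower line. Arcs of `m` pair the points off except
-- for the upper ends of crossing arcs.
open Classical in
theorem odd_card_crossing_iff {Q : StripPt} (hQ : Q ∈ C.strand m) (hQ' : C.cupS Q = Q)
    (hQu : ∀ x ∈ C.strand m, C.cupS x = x → x = C.base ∨ x = Q) :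
    Odd (((C.strandFinset m).filter fun x => (m.mate x).2 ≠ x.2).card / 2) ↔ Q.2 = true := by
  set A := C.strandFinset m
  have hAT : ∀ x ∈ A, m.mate x ∈ A := C.mate_mem_strandFinset m
  have hAF : ∀ x ∈ A, C.cupS x ∈ A := C.cupS_mem_strandFinset m
  set U := A.filter fun x => x.2 = true with hU
  set K := A.filter fun x => (m.mate x).2 ≠ x.2 with hK
  -- counting the points on the upper line with the arcs of `C`
  have h1 : Odd U.card ↔ Q.2 = true := by
    have e := even_card_filter_ne U C.cupS C.cupS_cupS (by
      intro x hx
      rw [hU, Finset.mem_filter] at hx ⊢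
      exact ⟨hAF x hx.1, by rw [C.cupS_snd]; exact hx.2⟩)
    rw [← Finset.card_filter_add_card_filter_not (fun x => C.cupS x = x), Nat.odd_add]
    simp only [e, iff_true]
    constructor
    · intro ho
      obtain ⟨x, hx⟩ := Finset.card_pos.1 ho.pos
      rw [Finset.mem_filter, hU, Finset.mem_filter] at hx
      rcases hQu x ((C.mem_strandFinset m).1 hx.1.1) hx.2 with rfl | rfl
      · have := hx.1.2
        simp [base, freeS] at this
      · exact hx.1.2
    · intro hq
      have : (U.filter fun x => C.cupS x = x) = {Q} := by
        ext x
        rw [Finset.mem_filter, hU, Finset.mem_filter, Finset.mem_singleton]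
        constructor
        · rintro ⟨⟨hx, hx2⟩, hfix⟩
          rcases hQu x ((C.mem_strandFinset m).1 hx) hfix with rfl | rfl
          · simp [base, freeS] at hx2
          · rfl
        · rintro rfl
          exact ⟨⟨(C.mem_strandFinset m).2 hQ, hq⟩, hQ'⟩
      rw [this]; simp
  -- counting them with the arcs of `m`
  have h2 : Odd U.card ↔ Odd (K.filter fun x => x.2 = true).card := by
    have e := even_card_filter_ne (U.filter fun x => ¬ (m.mate x).2 ≠ x.2) m.mate m.mate_mate (by
      intro x hx
      rw [Finset.mem_filter, hU, Finset.mem_filter] at hx ⊢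
      obtain ⟨⟨h1, h2⟩, h3⟩ := hx
      rw [not_not] at h3
      exact ⟨⟨hAT x h1, h3.trans h2⟩, by rw [m.mate_mate, h3]; simp⟩)
    rw [Finset.filter_true_of_mem (fun x _ => m.mate_ne x)] at e
    rw [← Finset.card_filter_add_card_filter_not (fun x => (m.mate x).2 ≠ x.2), Nat.odd_add]
    simp only [e, iff_true]
    rw [hU, hK, Finset.filter_filter, Finset.filter_filter]
    simp only [and_comm]
  -- Each crossing arc has one end on each line.
  have h3 : K.card = 2 * (K.filter fun x => x.2 = true).card := by
    rw [← Finset.card_filter_add_card_filter_not (s := K) (fun x => x.2 = true), two_mul,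
      add_right_inj]
    refine Finset.card_bij' (fun x _ => m.mate x) (fun x _ => m.mate x) ?_ ?_
      (fun x _ => m.mate_mate x) (fun x _ => m.mate_mate x)
    · intro x hx
      simp only [hK, Finset.mem_filter, m.mate_mate, ne_eq] at hx ⊢
      obtain ⟨⟨h1, h2⟩, h3⟩ := hx
      refine ⟨⟨hAT x h1, fun h => h2 h.symm⟩, ?_⟩
      revert h2 h3
      cases x.2 <;> cases (m.mate x).2 <;> simp
    · intro x hx
      simp only [hK, Finset.mem_filter, m.mate_mate, ne_eq] at hx ⊢
      obtain ⟨⟨h1, h2⟩, h3⟩ := hx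
      refine ⟨⟨hAT x h1, fun h => h2 h.symm⟩, ?_⟩
      revert h2 h3
      cases x.2 <;> cases (m.mate x).2 <;> simp
  rw [h3, Nat.mul_div_cancel_left _ two_pos, ← h2, h1]

end CupSystem

end KleinGram

/-! ### Types of the glued curves and the relation between three rows -/

namespace KleinGram

variable {n : ℕ}

open Classical in
/-- The type of the closed curve with ends of arcs in `S`. -/
noncomputable def typeOn (m₁ m₂ : Connection n) (S : Set (ZMod (2 * n))) : CurveType :=
  if Odd ({i ∈ S | m₁.Crosses i}.ncard / 2) then
    if Odd ({i ∈ S | m₂.Crosses i}.ncard / 2) then .w else .x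
  else
    if Odd ({i ∈ S | m₂.Crosses i}.ncard / 2) then .y else
      if ∀ p : StripPt, label n p ∈ S → p ∈ Function.periodicPts (m₂.mate ∘ m₁.mate) then .d
      else .z

/-- Products for different connections become comparable once they are indexed by the components of
one common graph. -/
theorem form_eq_prod [NeZero n] (m₁ m₂ : Connection n) (G : SimpleGraph (ZMod (2 * n)))
    [Fintype G.ConnectedComponent] (hG : glueGraph m₁ m₂ = G) :
    form m₁ m₂ = ∏ c : G.ConnectedComponent, MvPolynomial.X (typeOn m₁ m₂ c.supp) := by
  subst hG
  rw [form]
  exact Finset.prod_congr (Finset.ext fun _ => by simp only [Finset.mem_univ]) fun _ _ => rfl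

theorem Connection.Joins.symm {m : Connection n} {i j : ZMod (2 * n)} (h : m.Joins i j) :
    m.Joins j i := by
  obtain ⟨p, rfl, rfl⟩ := h
  exact ⟨m.mate p, rfl, by rw [m.mate_mate]⟩

theorem glueGraph_adj {m₁ m₂ : Connection n} {i j : ZMod (2 * n)} :
    (glueGraph m₁ m₂).Adj i j ↔ i ≠ j ∧ (m₁.Joins i j ∨ m₂.Joins i j) := by
  rw [glueGraph, SimpleGraph.fromRel_adj]
  have h1 : m₁.Joins j i ↔ m₁.Joins i j := ⟨.symm, .symm⟩
  have h2 : m₂.Joins j i ↔ m₂.Joins i j := ⟨.symm, .symm⟩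
  rw [h1, h2, or_self]

theorem label_left_mem_supp_iff {m₁ m₂ : Connection n} (c : ClosedCurve m₁ m₂) (p : StripPt) :
    label n (m₁.mate p) ∈ c.supp ↔ label n p ∈ c.supp := by
  by_cases h : label n p = label n (m₁.mate p)
  · rw [h]
  · exact (c.mem_supp_congr_adj (glueGraph_adj.2 ⟨h, Or.inl ⟨p, rfl, rfl⟩⟩)).symm

theorem label_right_mem_supp_iff {m₁ m₂ : Connection n} (c : ClosedCurve m₁ m₂) (p : StripPt) :
    label n (m₂.mate p) ∈ c.supp ↔ label n p ∈ c.supp := by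
  by_cases h : label n p = label n (m₂.mate p)
  · rw [h]
  · exact (c.mem_supp_congr_adj (glueGraph_adj.2 ⟨h, Or.inr ⟨p, rfl, rfl⟩⟩)).symm

theorem supp_subset_of_closed {m₁ m₂ : Connection n} {S : Set (ZMod (2 * n))} {i : ZMod (2 * n)}
    (hi : i ∈ S) (h1 : ∀ a ∈ S, ∀ b, m₁.Joins a b → b ∈ S) (h2 : ∀ a ∈ S, ∀ b, m₂.Joins a b → b ∈ S) :
    ((glueGraph m₁ m₂).connectedComponentMk i).supp ⊆ S := by
  intro j hj
  have hj : (glueGraph m₁ m₂).Reachable i j :=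
    (SimpleGraph.ConnectedComponent.eq.1 ((SimpleGraph.ConnectedComponent.mem_supp_iff _ _).1 hj)).symm
  obtain ⟨w⟩ := hj
  clear * - w hi h1 h2
  induction w with
  | nil => exact hi
  | cons hadj _ ih =>
    rcases (glueGraph_adj.1 hadj).2 with h | h
    · exact ih (h1 _ hi _ h)
    · exact ih (h2 _ hi _ h)

theorem mem_periodicPts_of_eqOn {α : Type*} {f g : α → α} {S : Set α} (hS : ∀ x ∈ S, f x ∈ S)
    (hfg : ∀ x ∈ S, f x = g x) {x : α} (hx : x ∈ S) (h : x ∈ Function.periodicPts f) :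
    x ∈ Function.periodicPts g := by
  obtain ⟨k, hk, hp⟩ := h
  refine ⟨k, hk, ?_⟩
  have : ∀ k, g^[k] x = f^[k] x ∧ f^[k] x ∈ S := by
    intro k
    induction k with
    | zero => exact ⟨rfl, hx⟩
    | succ k ih =>
      rw [Function.iterate_succ_apply', Function.iterate_succ_apply', ih.1]
      exact ⟨(hfg _ ih.2).symm, hS _ ih.2⟩
  rw [Function.IsPeriodicPt, Function.IsFixedPt, (this k).1]
  exact hp

theorem mem_periodicPts_of_finite {α : Type*} {f : α → α} (hf : Function.Injective f) {S : Set α}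
    (hfin : S.Finite) (hS : ∀ x ∈ S, f x ∈ S) {x : α} (hx : x ∈ S) :
    x ∈ Function.periodicPts f := by
  have h : ∀ k : ℕ, f^[k] x ∈ S := by
    intro k
    induction k with
    | zero => exact hx
    | succ k ih => rw [Function.iterate_succ_apply']; exact hS _ ih
  obtain ⟨a, b, hab, e⟩ := hfin.exists_lt_map_eq_of_forall_mem h
  refine ⟨b - a, by omega, hf.iterate a ?_⟩
  rw [← Function.iterate_add_apply, Nat.add_sub_cancel' hab.le, e]

namespace CupSystem

variable (C : CupSystem n) (m : Connection n)

/-- With only two labels, every connection in the band with n = 1 joins the same pair; so the glued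
graph does not depend on the new arc. -/
theorem insert_joins [NeZero n] (u v : Connection 1) {i j : ZMod (2 * n)}
    (h : (C.insert u).Joins i j) : (C.insert v).Joins i j := by
  obtain ⟨p, rfl, rfl⟩ := h
  refine ⟨p, rfl, ?_⟩
  rcases C.free_or_cup p with ⟨x, rfl⟩ | hp
  · rw [C.insert_mate_freeS, C.insert_mate_freeS]
    apply C.label_freeS
    have h1 := u.label_mate_ne x
    have h2 := v.label_mate_ne x
    revert h1 h2
    generalize label 1 (u.mate x) = a
    generalize label 1 (v.mate x) = b
    generalize label 1 x = c
    revert a b c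
    decide
  · rw [C.insert_mate_of_ne u hp, C.insert_mate_of_ne v hp]

theorem glueGraph_insert [NeZero n] (u v : Connection 1) :
    glueGraph (C.insert u) m = glueGraph (C.insert v) m := by
  ext i j
  rw [glueGraph_adj, glueGraph_adj]
  have h : (C.insert u).Joins i j ↔ (C.insert v).Joins i j :=
    ⟨C.insert_joins u v, C.insert_joins v u⟩
  rw [h]

theorem freeS_mem_labels [NeZero n] (x : StripPt) :
    label n (C.freeS x) ∈ label n '' C.strand m := by
  obtain ⟨k, hk, -⟩ := C.exists_strand_end m
  rcases C.cupS_eq_self_cases (C.cupS_freeS x) with ⟨l, hl⟩ | ⟨l, hl⟩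
  · exact ⟨_, C.base_mem_strand m, by rw [hl, label_zpow]⟩
  · exact ⟨_, hk, by rw [hl, label_zpow, label_zpow]⟩

theorem supp_base [NeZero n] (u : Connection 1) :
    ((glueGraph (C.insert u) m).connectedComponentMk (label n C.base)).supp =
      label n '' C.strand m := by
  apply Set.Subset.antisymm
  · refine supp_subset_of_closed ⟨_, C.base_mem_strand m, rfl⟩ ?_ ?_
    · rintro _ ⟨p, hp, rfl⟩ j hj
      rw [Connection.joins_iff] at hj
      subst hj
      rcases C.free_or_cup p with ⟨x, rfl⟩ | h
      · rw [C.insert_mate_freeS]; exact C.freeS_mem_labels m _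
      · rw [C.insert_mate_of_ne u h]; exact ⟨_, C.cupS_mem_strand m hp, rfl⟩
    · rintro _ ⟨p, hp, rfl⟩ j hj
      rw [Connection.joins_iff] at hj
      subst hj
      exact ⟨_, C.mate_mem_strand m hp, rfl⟩
  · rintro _ ⟨p, hp, rfl⟩
    have := C.strand_induction m (k := 0) (B := {x | label n x ∈
      ((glueGraph (C.insert u) m).connectedComponentMk (label n C.base)).supp}) ?_ ?_ ?_ p hp
    · simpa using this
    · intro x hx
      rcases C.free_or_cup x with ⟨y, rfl⟩ | h
      · rwa [C.cupS_freeS]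
      · rw [← C.insert_mate_of_ne u h]
        exact (label_left_mem_supp_iff _ _).2 hx
    · exact fun x hx => (label_right_mem_supp_iff _ _).2 hx
    · exact (SimpleGraph.ConnectedComponent.mem_supp_iff _ _).2 rfl

/-- The new arc only affects the type of the curve that contains it. -/
theorem typeOn_insert [NeZero n] (u v : Connection 1) (c : ClosedCurve (C.insert u) m)
    (hc : c ≠ (glueGraph (C.insert u) m).connectedComponentMk (label n C.base)) :
    typeOn (C.insert u) m c.supp = typeOn (C.insert v) m c.supp := by
  have hfree : ∀ x, label n (C.freeS x) ∉ c.supp := by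
    intro x hx
    have h := C.freeS_mem_labels m x
    rw [← C.supp_base m u] at h
    exact hc (((SimpleGraph.ConnectedComponent.mem_supp_iff _ _).1 hx).symm.trans
      ((SimpleGraph.ConnectedComponent.mem_supp_iff _ _).1 h))
  have hne : ∀ p, label n p ∈ c.supp → C.cupS p ≠ p := by
    intro p hp h
    obtain ⟨x, rfl⟩ := (C.cupS_eq_self_iff p).1 h
    exact hfree x hp
  have hmate : ∀ p, label n p ∈ c.supp → (C.insert u).mate p = (C.insert v).mate p := by
    intro p hp
    rw [C.insert_mate_of_ne u (hne p hp), C.insert_mate_of_ne v (hne p hp)]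
  have h1 : {i ∈ c.supp | (C.insert u).Crosses i} = {i ∈ c.supp | (C.insert v).Crosses i} := by
    ext i
    obtain ⟨p, rfl⟩ := label_surjective i
    simp only [Set.mem_ofPred_eq, and_congr_right_iff, Connection.crosses_label]
    exact fun hp => by rw [hmate p hp]
  have h2 : (∀ p : StripPt, label n p ∈ c.supp →
        p ∈ Function.periodicPts (m.mate ∘ (C.insert u).mate)) ↔
      ∀ p : StripPt, label n p ∈ c.supp →
        p ∈ Function.periodicPts (m.mate ∘ (C.insert v).mate) := by
    have hS : ∀ x ∈ {p | label n p ∈ c.supp}, (m.mate ∘ (C.insert u).mate) x ∈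
        {p | label n p ∈ c.supp} := fun x hx =>
      (label_right_mem_supp_iff c _).2 ((label_left_mem_supp_iff c _).2 hx)
    have hE : ∀ x ∈ {p | label n p ∈ c.supp}, (m.mate ∘ (C.insert u).mate) x =
        (m.mate ∘ (C.insert v).mate) x := fun x hx => congrArg m.mate (hmate x hx)
    refine forall₂_congr fun p hp => ⟨mem_periodicPts_of_eqOn hS hE hp,
      mem_periodicPts_of_eqOn (fun x hx => hE x hx ▸ hS x hx) (fun x hx => (hE x hx).symm) hp⟩
  rw [typeOn, typeOn, h1]
  classical
  exact if_congr Iff.rfl rfl (if_congr Iff.rfl rfl (if_congr h2 rfl rfl))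

theorem exists_form_insert [NeZero n] : ∃ R : MvPolynomial CurveType ℤ, ∀ u : Connection 1,
    form (C.insert u) m = MvPolynomial.X (typeOn (C.insert u) m (label n '' C.strand m)) * R := by
  classical
  -- An arbitrary reference arc: the curves missing the free points have the same type for every
  -- choice.
  let v := crossArc
  let c₀ : ClosedCurve (C.insert v) m :=
    (glueGraph (C.insert v) m).connectedComponentMk (label n C.base)
  refine ⟨∏ c ∈ Finset.univ.erase c₀, MvPolynomial.X (typeOn (C.insert v) m c.supp), fun u => ?_⟩
  rw [form_eq_prod _ _ (glueGraph (C.insert v) m) (C.glueGraph_insert m u v),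
    ← Finset.mul_prod_erase _ _ (Finset.mem_univ c₀), C.supp_base m v]
  congr 1
  refine Finset.prod_congr rfl fun c hc => ?_
  rw [C.typeOn_insert m v u c (Finset.ne_of_mem_erase hc)]

theorem ncard_outer [NeZero n] : {i ∈ label n '' C.strand m | m.Crosses i}.ncard =
    ((C.strandFinset m).filter fun x => (m.mate x).2 ≠ x.2).card := by
  rw [← Set.ncard_coe_finset]
  have e : {i ∈ label n '' C.strand m | m.Crosses i} =
      label n '' ((C.strandFinset m).filter fun x => (m.mate x).2 ≠ x.2 : Finset StripPt) := by
    ext i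
    simp only [Set.mem_ofPred_eq, Finset.coe_filter, mem_strandFinset, Set.mem_image]
    constructor
    · rintro ⟨⟨p, hp, rfl⟩, h⟩
      exact ⟨p, ⟨hp, (m.crosses_label p).1 h⟩, rfl⟩
    · rintro ⟨p, ⟨hp, h⟩, rfl⟩
      exact ⟨⟨p, hp, rfl⟩, (m.crosses_label p).2 h⟩
  rw [e, Set.InjOn.ncard_image]
  refine (C.label_injOn_strand m).mono fun x hx => ?_
  simpa using (Finset.mem_filter.1 (Finset.mem_coe.1 hx)).1

theorem inner_sideArc (b : Bool) (S : Set (ZMod (2 * n))) [NeZero n] :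
    {i ∈ S | (C.insert (sideArc b)).Crosses i} = ∅ := by
  refine Set.eq_empty_of_forall_notMem fun i hi => ?_
  obtain ⟨p, rfl⟩ := label_surjective i
  have h := ((C.insert (sideArc b)).crosses_label p).1 hi.2
  rcases C.free_or_cup p with ⟨x, rfl⟩ | hp
  · rw [C.insert_mate_freeS, C.freeS_snd, C.freeS_snd] at h
    exact h rfl
  · rw [C.insert_mate_of_ne _ hp, C.cupS_snd] at h
    exact h rfl

theorem label_base_ne [NeZero n] : label n C.base ≠ label n (C.freeS (1, false)) := by
  intro h
  obtain ⟨k, hk⟩ := label_eq_iff.1 h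
  rw [base, ← C.freeS_zpow] at hk
  have h1 := label_eq_iff.2 ⟨k, C.freeS_injective hk⟩
  revert h1
  simp only [label]
  decide

theorem inner_crossArc [NeZero n] :
    {i ∈ label n '' C.strand m | (C.insert crossArc).Crosses i}.ncard = 2 := by
  refine Eq.trans ?_ (Set.ncard_pair C.label_base_ne)
  congr 1
  ext i
  simp only [Set.mem_ofPred_eq, Set.mem_insert_iff, Set.mem_singleton_iff]
  have hcross : ∀ x, (C.insert crossArc).Crosses (label n (C.freeS x)) := by
    intro x
    rw [Connection.crosses_label, C.insert_mate_freeS, C.freeS_snd, C.freeS_snd]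
    simp [crossArc]
  constructor
  · rintro ⟨-, h⟩
    obtain ⟨p, rfl⟩ := label_surjective i
    rw [Connection.crosses_label] at h
    by_cases hp : C.cupS p = p
    · rcases C.cupS_eq_self_cases hp with ⟨k, rfl⟩ | ⟨k, rfl⟩
      · exact Or.inl (label_zpow k _)
      · exact Or.inr (label_zpow k _)
    · rw [C.insert_mate_of_ne _ hp, C.cupS_snd] at h
      exact absurd rfl h
  · rintro (rfl | rfl)
    · exact ⟨C.freeS_mem_labels m _, hcross _⟩
    · exact ⟨C.freeS_mem_labels m _, hcross _⟩

/-- When the new arc joins the two ends of one lift, the finite strand is invariant under an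
injective map, so its points are periodic; periodicity passes to the translates. -/
theorem lifts_closed [NeZero n] (u : Connection 1) {Q : StripPt} (hQ : Q ∈ C.strand m)
    (hQu : ∀ x ∈ C.strand m, C.cupS x = x → x = C.base ∨ x = Q)
    (hu : (C.insert u).mate Q = C.base) :
    ∀ p : StripPt, label n p ∈ label n '' C.strand m →
      p ∈ Function.periodicPts (m.mate ∘ (C.insert u).mate) := by
  rintro p ⟨a, ha, hp⟩
  obtain ⟨k, rfl⟩ := label_eq_iff.1 hp
  have hinj : Function.Injective (m.mate ∘ (C.insert u).mate) :=
    m.matePerm.injective.comp (C.insert u).matePerm.injective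
  have hS : ∀ x ∈ C.strand m, (m.mate ∘ (C.insert u).mate) x ∈ C.strand m := by
    intro x hx
    refine C.mate_mem_strand m ?_
    by_cases hfix : C.cupS x = x
    · rcases hQu x hx hfix with rfl | rfl
      · rw [← hu, Connection.mate_mate]; exact hQ
      · rw [hu]; exact C.base_mem_strand m
    · rw [C.insert_mate_of_ne u hfix]; exact C.cupS_mem_strand m hx
  obtain ⟨N, hN, hper⟩ := mem_periodicPts_of_finite hinj (C.strand_finite m) hS ha
  refine ⟨N, hN, hper.map (g := (deckPerm n ^ k : Equiv.Perm StripPt)) fun x => ?_⟩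
  simp only [Function.comp_apply, Connection.mate_zpow]

/-- When the new arc leads from `Q` to a proper translate of `base`, the lifted curve runs through
infinitely many translates of the strand, whereas a periodic orbit is finite. -/
theorem not_lifts_closed [NeZero n] (u : Connection 1) {Q : StripPt} (hQ : Q ∈ C.strand m)
    {k : ℤ} (hk : k ≠ 0) (hu : (C.insert u).mate Q = (deckPerm n ^ k) C.base) :
    ¬ ∀ p : StripPt, label n p ∈ label n '' C.strand m →
      p ∈ Function.periodicPts (m.mate ∘ (C.insert u).mate) := by
  intro hall
  obtain ⟨N, hN, hper⟩ := hall C.base ⟨_, C.base_mem_strand m, rfl⟩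
  set f := m.mate ∘ (C.insert u).mate with hf
  -- All points on the lifted curve through `base`: the orbit visits every other one, and the inner
  -- mates supply the rest.
  let B : Set StripPt := {x | ∃ i : ℕ, x = f^[i] C.base ∨ x = (C.insert u).mate (f^[i] C.base)}
  have hfin : B.Finite := by
    refine Set.Finite.subset (((Finset.range N).image fun i => f^[i] C.base) ∪
      ((Finset.range N).image fun i => (C.insert u).mate (f^[i] C.base))).finite_toSet ?_
    rintro x ⟨i, hi⟩
    rw [← hper.iterate_mod_apply i] at hi
    simp only [Finset.coe_union, Finset.coe_image, Set.mem_union, Set.mem_image, Finset.coe_range,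
      Set.mem_Iio]
    exact hi.imp (fun e => ⟨_, Nat.mod_lt _ hN, e.symm⟩) (fun e => ⟨_, Nat.mod_lt _ hN, e.symm⟩)
  have hmate : ∀ x ∈ B, (C.insert u).mate x ∈ B := by
    rintro x ⟨i, rfl | rfl⟩
    · exact ⟨i, Or.inr rfl⟩
    · exact ⟨i, Or.inl (Connection.mate_mate _ _)⟩
  have hcup : ∀ x ∈ B, C.cupS x ∈ B := by
    intro x hx
    by_cases hfix : C.cupS x = x
    · rwa [hfix]
    · rw [← C.insert_mate_of_ne u hfix]; exact hmate x hx
  have hsucc : ∀ i : ℕ, m.mate (f^[i + 1] C.base) = (C.insert u).mate (f^[i] C.base) := by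
    intro i
    rw [Function.iterate_succ_apply', hf, Function.comp_apply, m.mate_mate]
  have hout : ∀ x ∈ B, m.mate x ∈ B := by
    rintro x ⟨i, rfl | rfl⟩
    · cases i with
      | zero =>
        obtain ⟨N, rfl⟩ : ∃ M, N = M + 1 := ⟨N - 1, by omega⟩
        have := hsucc N
        rw [hper.eq] at this
        exact ⟨N, Or.inr this⟩
      | succ i => exact ⟨i, Or.inr (hsucc i)⟩
    · exact ⟨i + 1, Or.inl (by rw [Function.iterate_succ_apply']; rfl)⟩
  have hmem : ∀ i : ℕ, (deckPerm n ^ (k * i)) C.base ∈ B := by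
    intro i
    induction i with
    | zero => exact ⟨0, Or.inl (by simp)⟩
    | succ i ih =>
      have h := hmate _ (C.strand_induction m hcup hout ih Q hQ)
      rw [Connection.mate_zpow, hu, ← Equiv.Perm.mul_apply, ← zpow_add] at h
      rwa [Nat.cast_succ, mul_add, mul_one]
  refine Set.infinite_of_injective_forall_mem (f := fun i : ℕ => (deckPerm n ^ (k * i)) C.base)
    (fun i j hij => ?_) hmem hfin
  have h1 := congrArg Prod.fst hij
  simp only [deckPerm_zpow_fst, add_right_inj] at h1
  have hn : (n : ℤ) ≠ 0 := by exact_mod_cast NeZero.ne n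
  have h2 := mul_left_cancel₀ hk (mul_right_cancel₀ hn h1)
  exact_mod_cast h2

theorem freeS_even (k : ℤ) : C.freeS (2 * k, false) = (deckPerm n ^ (2 * k)) C.base := by
  rw [base, ← C.freeS_zpow, deckPerm_zpow_two_mul]
  congr 2
  push_cast; ring

/-- The possible types of the curve through the new arc, which is one of the two arcs off the
crosscap or the arc through the crosscap. -/
theorem typeOn_strand [NeZero n] :
    (typeOn (C.insert crossArc) m (label n '' C.strand m) = .w ∧
      ∀ b, typeOn (C.insert (sideArc b)) m (label n '' C.strand m) = .y) ∨
    (typeOn (C.insert crossArc) m (label n '' C.strand m) = .x ∧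
      ∃ b, typeOn (C.insert (sideArc b)) m (label n '' C.strand m) = .d ∧
        typeOn (C.insert (sideArc !b)) m (label n '' C.strand m) = .z) := by
  classical
  obtain ⟨k, hQ, hQu⟩ := C.exists_strand_end m
  set Q := (deckPerm n ^ k) (C.freeS (1, false)) with hQdef
  have hQfix : C.cupS Q = Q := by rw [hQdef, C.cupS_zpow, C.cupS_freeS]
  have hodd := C.odd_card_crossing_iff m hQ hQfix hQu
  have hin : ∀ b, ¬ Odd ({i ∈ label n '' C.strand m |
      (C.insert (sideArc b)).Crosses i}.ncard / 2) := by
    intro b; rw [C.inner_sideArc]; simp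
  have hin' : Odd ({i ∈ label n '' C.strand m | (C.insert crossArc).Crosses i}.ncard / 2) := by
    rw [C.inner_crossArc]; decide
  have hout := C.ncard_outer m
  rw [← hout] at hodd
  by_cases hQ2 : Q.2 = true
  · left
    rw [hQ2, eq_self_iff_true, iff_true] at hodd
    refine ⟨?_, fun b => ?_⟩
    · rw [typeOn, if_pos hin', if_pos hodd]
    · rw [typeOn, if_neg (hin b), if_pos hodd]
  · right
    rw [iff_false_intro hQ2, iff_false] at hodd
    refine ⟨by rw [typeOn, if_pos hin', if_neg hodd], ?_⟩
    have hside : ∀ b, typeOn (C.insert (sideArc b)) m (label n '' C.strand m) =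
        if ∀ p : StripPt, label n p ∈ label n '' C.strand m →
          p ∈ Function.periodicPts (m.mate ∘ (C.insert (sideArc b)).mate) then .d else .z := by
      intro b
      rw [typeOn, if_neg (hin b), if_neg hodd]
    -- On the lower line `Q` has odd index 1 + 2l, and `strand_ends_le`, applied with `Q` as right
    -- or as left end, leaves only l = 0 and l = -1.
    have hj : Q = C.freeS (1, false) ∨ Q = C.freeS (-1, false) := by
      rcases Int.even_or_odd' k with ⟨l, rfl | rfl⟩
      · rw [hQdef, ← C.freeS_zpow, deckPerm_zpow_two_mul] at hQ hQu ⊢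
        have hQ' : C.freeS (1 + l * (2 * (1 : ℕ)), false) ∈ C.strand m := hQ
        rcases le_or_gt 0 l with h | h
        · have := C.strand_ends_le m (C.base_mem_strand m) hQ' hQu
          have : l = 0 := by push_cast at this; omega
          subst this; simp
        · have := C.strand_ends_le m hQ' (C.base_mem_strand m) fun x hx hf => (hQu x hx hf).symm
          have : l = -1 := by push_cast at this; omega
          subst this; simp
      · exfalso
        apply hQ2
        rw [hQdef, ← C.freeS_zpow, C.freeS_snd, add_comm, zpow_one_add, Equiv.Perm.mul_apply,
          deckPerm_zpow_two_mul]
        rfl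
    rcases hj with h | h
    · refine ⟨false, ?_, ?_⟩
      · rw [hside, if_pos]
        refine C.lifts_closed m _ hQ hQu ?_
        rw [h, C.insert_mate_freeS, base]
        congr 1
      · rw [hside, if_neg]
        -- The other side arc joins free point 1 to free point 2, the translate of `base` by one
        -- period.
        refine C.not_lifts_closed m _ hQ (k := 2 * 1) (by norm_num) ?_
        rw [h, C.insert_mate_freeS, ← C.freeS_even]
        congr 1
    · refine ⟨true, ?_, ?_⟩
      · rw [hside, if_pos]
        refine C.lifts_closed m _ hQ hQu ?_
        rw [h, C.insert_mate_freeS, base]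
        congr 1
      · rw [hside, if_neg]
        refine C.not_lifts_closed m _ hQ (k := 2 * (-1)) (by norm_num) ?_
        rw [h, C.insert_mate_freeS, ← C.freeS_even]
        congr 1

open MvPolynomial in
theorem dvd_form_combination [NeZero n] :
    (X CurveType.w * (X CurveType.d + X CurveType.z) - 2 * (X CurveType.x * X CurveType.y) :
      MvPolynomial CurveType ℤ) ∣ (X CurveType.d + X CurveType.z) * form (C.insert crossArc) m -
        X CurveType.x * (form (C.insert (sideArc false)) m + form (C.insert (sideArc true)) m) := by
  obtain ⟨R, hR⟩ := C.exists_form_insert m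
  rw [hR, hR, hR]
  rcases C.typeOn_strand m with ⟨h1, h2⟩ | ⟨h1, b, h2, h3⟩
  · rw [h1, h2, h2]
    exact ⟨R, by ring⟩
  · rw [h1]
    cases b
    · rw [h2, show sideArc true = sideArc !false from rfl, h3]
      exact ⟨0, by ring⟩
    · rw [h2, show sideArc false = sideArc !true from rfl, h3]
      exact ⟨0, by ring⟩

/-- The right-hand side has an arc through the crosscap, at the free points of `C`, while the
left-hand side has none. -/
theorem insert_crossArc_ne (D : CupSystem n) (b : Bool) :
    D.insert (sideArc b) ≠ C.insert crossArc := by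
  intro h
  have h1 := congrArg (fun m : Connection n => (m.mate (C.freeS (0, false))).2) h
  simp only [C.insert_mate_freeS, C.freeS_snd] at h1
  rcases D.free_or_cup (C.freeS (0, false)) with ⟨x, hx⟩ | hp
  · have h2 : x.2 = false := by rw [← D.freeS_snd, ← hx]; rfl
    rw [hx, D.insert_mate_freeS, D.freeS_snd] at h1
    simp [sideArc, crossArc, h2] at h1
  · rw [D.insert_mate_of_ne _ hp, D.cupS_snd] at h1
    simp [crossArc, freeS] at h1

/-- Reads the left ends of the arcs of `C` off the crossing connection, so that different index sets
give different crossing rows. -/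
theorem lt_cup_iff_insert (i : ℤ) : i < C.cup i ↔
    ((C.insert crossArc).mate (i, false)).2 = false ∧
      i < ((C.insert crossArc).mate (i, false)).1 := by
  rcases C.free_or_cup (i, false) with ⟨x, hx⟩ | hp
  · have h := C.cupS_freeS x
    rw [← hx] at h
    have h1 : C.cup i = i := congrArg Prod.fst h
    have h2 : x.2 = false := by rw [← C.freeS_snd, ← hx]
    rw [hx, C.insert_mate_freeS, C.freeS_snd]
    simp [crossArc, h1, h2]
  · rw [C.insert_mate_of_ne _ hp]
    simp [cupS]

end CupSystem

end KleinGram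

theorem mainTheorem5 (n : ℕ) [NeZero n] :
    (MvPolynomial.X KleinGram.CurveType.w *
          (MvPolynomial.X KleinGram.CurveType.d + MvPolynomial.X KleinGram.CurveType.z) -
        2 * (MvPolynomial.X KleinGram.CurveType.x * MvPolynomial.X KleinGram.CurveType.y)) ^
        Nat.choose (2 * n) (n - 1) ∣
      KleinGram.gramDet n := by
  classical
  obtain ⟨C, hC⟩ := KleinGram.exists_cupSystem_family n
  have hcard : Fintype.card {S : Finset (Fin (2 * n)) // S.card = n - 1} =
      Nat.choose (2 * n) (n - 1) := by
    rw [Fintype.card_finset_len, Fintype.card_fin]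
  have h := Matrix.pow_card_dvd_mul_det (KleinGram.gramMatrix n)
    (fun S => (C S).insert (KleinGram.sideArc false))
    (fun S => (C S).insert (KleinGram.sideArc true))
    (fun S => (C S).insert KleinGram.crossArc)
    (fun S S' e => hC S S' fun i => by
      rw [KleinGram.CupSystem.lt_cup_iff_insert, KleinGram.CupSystem.lt_cup_iff_insert]
      rw [show (C S).insert KleinGram.crossArc = (C S').insert KleinGram.crossArc from e])
    (fun S S' => (C S').insert_crossArc_ne (C S) false)
    (fun S S' => (C S').insert_crossArc_ne (C S) true) _ (MvPolynomial.X KleinGram.CurveType.x) _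
    (fun S m => (C S).dvd_form_combination m)
  rw [hcard] at h
  -- The row operations multiplied the determinant by a power of d + z, which coprimality now
  -- removes.
  have h2 := (KleinGram.isRelPrime_d_add_z.pow (m := Nat.choose (2 * n) (n - 1))
    (n := Nat.choose (2 * n) (n - 1))).dvd_of_dvd_mul_left h
  rw [KleinGram.gramDet]
  convert h2
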